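/- **Setting.** Consider $\min\{f(z)+h(z) : Az=b,\ z\in\mathbb R^n\}$ with $b\in\mathbb R^l$, where * (C1) $h:\mathbb R^n\to(-\infty,+\infty]$ is proper, lower semicontinuous and convex, $A:\mathbb R^n\to\mathbb R^l$ is linear, $A\neq 0$, and $\mathcal F:=\{z\in\operatorname{dom}h : Az=b\}\ne\emptyset$; * (C2) $f:\mathbb R^n\to\mathbb R$ is differentiable at every point of $\operatorname{dom}h$, and there are scalars $0<m_f\le L_f$ such that for all $u,z\in\operatorname{dom}h$: $\|\nabla f(z)-\nabla f(u)\|\le L_f\|z-u\|$ and $f(z)+\langle\nabla f(z),u-z\rangle-\frac{m_f}{2}\|u-z\|^2\le f(u)$; * (C3) $\hat c\ge 0$ is such that $\hat\varphi_{\hat c}>-\infty$, where $\varphi_c(z):=f(z)+h(z)+\frac c2\|Az-b\|^2$ and $\hat\varphi_c:=\inf_z\varphi_c(z)$. Let $z_0\in\operatorname{dom}h$, $\sigma\in(0,1)$ and tolerances $\hat\rho,\hat\eta>0$. All norms are Euclidean and $\|A\|$ is the operator norm. $\partial_\varepsilon\psi(z)=\{v:\psi(u)\ge\psi(z)+\langle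 v,u-z\rangle-\varepsilon\ \forall u\}$ for $z\in\operatorname{dom}\psi$, $\partial=\partial_0$, $\ell_\psi(u;z)=\psi(z)+\langle\nabla\psi(z),u-z\rangle$ and $\log_1^+t=\max\{\log t,1\}$. **ACG method** for $\psi_s+\psi_n$ with constants $\mu,L$, started from $x_0$. Put $y_0=x_0$, $A_0=0$, $\Gamma_0\equiv0$. Iteration $j+1$ computes $A_{j+1}=A_j+\frac{\mu A_j+1+\sqrt{(\mu A_j+1)^2+4L(\mu A_j+1)A_j}}{2L}$, $\tilde x_j=\frac{A_j}{A_{j+1}}x_j+\frac{A_{j+1}-A_j}{A_{j+1}}y_j$, $\Gamma_{j+1}=\frac{A_j}{A_{j+1}}\Gamma_j+\frac{A_{j+1}-A_j}{A_{j+1}}\ell_{\psi_s}(\cdot;\tilde x_j)$, $y_{j+1}=\operatorname{argmin}_y\{\Gamma_{j+1}(y)+\psi_n(y)+\frac1{2A_{j+1}}\|y-y_0\|^2\}$, $x_{j+1}=\frac{A_j}{A_{j+1}}x_j+\frac{A_{j+1}-A_j}{A_{j+1}}y_{j+1}$, and also $u_{j+1}=(y_0-y_{j+1})/A_{j+1}$,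 $\eta_{j+1}=(\psi_s+\psi_n)(x_{j+1})-\Gamma_{j+1}(y_{j+1})-\psi_n(y_{j+1})-\langle u_{j+1},x_{j+1}-y_{j+1}\rangle$. **AIPP method** for $g+h$ with inputs $z_0,\sigma,M,\lambda,\bar\rho,\bar\varepsilon$. In outer iteration $k=1,2,\dots$, run the ACG method from $z_{k-1}$ with $\psi_s=\lambda g+\frac14\|\cdot-z_{k-1}\|^2$, $\psi_n=\lambda h+\frac14\|\cdot-z_{k-1}\|^2$, $\mu=\frac12$, $L=\lambda M+\frac12$, up to the first iteration $j\ge\lceil6\sqrt{2\lambda M+1}\rceil$ whose triple $(x,u,\eta)=(x_j,u_j,\eta_j)$ satisfies $$\eta\ge0,\quad u\in\partial_\eta\big(\lambda(g+h)+\tfrac12\|\cdot-z_{k-1}\|^2\big)(x),\quad \|u\|^2+2\eta\le\sigma\|z_{k-1}-x+u\|^2.\qquad(*)$$ If $\|z_{k-1}-x+u\|>\lambda\bar\rho/5$, set $z_k=x$ and go to the next outer iteration. Otherwise continue the same ACG run up to the first iteration $j'\ge j$ whose triple $(\tilde x,\tilde u,\tilde\eta)$ satisfies $(*)$ and $\tilde\eta/\lambda\le\bar\varepsilon$,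 and output $(z^-,z,w,\varepsilon)=(z_{k-1},\tilde x,\tilde u/\lambda,\tilde\eta/\lambda)$. **QP-AIPP method.** Put $\lambda=\frac1{2m_f}$ and $c=\hat c+L_f/\|A\|^2$. Loop: 1. With $g=g_c:=f+\frac c2\|A\cdot-b\|^2$ and $M=L_f+c\|A\|^2$, apply the AIPP method from $z_0$ with $\sigma$, $M$, $\lambda$ and $(\bar\rho,\bar\varepsilon)=\big(\frac{\hat\rho}4,\frac{\hat\rho^2}{32(M+2m_f)}\big)$, and let $z$ be the second component of its output. 2. Compute $z_g=\operatorname{argmin}_u\{\ell_g(u;z)+h(u)+\frac{M+\lambda^{-1}}2\|u-z\|^2\}$ and $v_g=(M+\lambda^{-1})(z-z_g)+\nabla g(z_g)-\nabla g(z)$. 3. If $\|Az_g-b\|>\hat\eta$, replace $c$ by $2c$ and repeat; otherwise stop and output $(\hat z,\hat v,\hat p)=(z_g,v_g,c(Az_g-b))$. The *inner iterations* are all ACG iterations performed in all calls of the ACG method. **Theorem (QP-AIPP complexity).** Put $$R_{\hat c}(\lambda)=\inf_{u\in\mathcal F}\Big\{\tfrac12\|z_0-u\|^2+(1-\sigma)\lambda[\varphi_{\hat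 c}(u)-\hat\varphi_{\hat c}]\Big\},\quad T_{\hat\eta}=\frac{2R_{\hat c}(\lambda)}{\hat\eta^2(1-\sigma)\lambda}+\hat c,\quad \Theta=\frac{L_f+T_{\hat\eta}\|A\|^2}{m_f}.$$ (i) For every $\sigma\in(0,1)$ there is a constant $C=C(\sigma)>0$ such that, for all $n,l$, all data $f,h,A,b,L_f,m_f,\hat c$ satisfying (C1)–(C3), all $z_0\in\operatorname{dom}h$ and all $\hat\rho,\hat\eta>0$, the QP-AIPP method terminates, its output satisfies $$\hat v\in\nabla f(\hat z)+\partial h(\hat z)+A^*\hat p,\qquad\|\hat v\|\le\hat\rho,\qquad\|A\hat z-b\|\le\hat\eta,$$ and its total number of inner iterations is at most $$C\,\sqrt\Theta\left[\frac{m_f^2R_{\hat c}(\lambda)}{\hat\rho^2}+\log_1^+(\Theta)\right].$$ (ii) In terms of the tolerances alone: for fixed $\sigma$, problem data and $z_0$, there is a constant $C'$ such that for all $\hat\rho,\hat\eta\in(0,1]$ the number of inner iterations is at most $C'\,\hat\eta^{-1}\big(\hat\rho^{-2}+\log_1^+(1/\hat\eta)\big)$. Hence it is $O(\hat\rho^{-2}\hat\eta^{-1})$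 as long as the logarithmic term does not dominate: for every $K$ there is a constant $C''$, depending only on $K$, $\sigma$, the problem data and $z_0$, such that it is at most $C''\hat\rho^{-2}\hat\eta^{-1}$ for all $\hat\rho,\hat\eta\in(0,1]$ with $\log(1/\hat\eta)\le K\hat\rho^{-2}$. -/

import Mathlib

noncomputable section

namespace QPAIPP

/-- The Euclidean space of dimension `n`. -/
abbrev Vec (n : ℕ) := EuclideanSpace ℝ (Fin n)

/-- The truncated logarithm `max {log t, 1}`. -/
def logOnePlus (t : ℝ) : ℝ := max (Real.log t) 1

/-- The effective domain of an extended-real-valued function. -/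
def effDom {n : ℕ} (ψ : Vec n → EReal) : Set (Vec n) := {x | ψ x < ⊤}

/-- Proper, lower semicontinuous, convex functions with values in `(-∞, +∞]`. -/
structure IsProperClosedConvex {n : ℕ} (ψ : Vec n → EReal) : Prop where
  ne_bot : ∀ x, ψ x ≠ ⊥
  nonempty_dom : (effDom ψ).Nonempty
  lsc : LowerSemicontinuous ψ
  convex : ∀ x ∈ effDom ψ, ∀ y ∈ effDom ψ, ∀ α ∈ Set.Icc (0 : ℝ) 1,
    ψ (α • x + (1 - α) • y) ≤ (α : EReal) * ψ x + ((1 - α : ℝ) : EReal) * ψ y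

/-- The `ε`-subdifferential of `ψ` at a point `z` of its domain. -/
def epsSubdiff {n : ℕ} (ε : ℝ) (ψ : Vec n → EReal) (z : Vec n) : Set (Vec n) :=
  {v | z ∈ effDom ψ ∧ ∀ u, ψ z + ((inner ℝ v (u - z) - ε : ℝ) : EReal) ≤ ψ u}

/-- The subdifferential of `ψ` at `z`. -/
def subdiff {n : ℕ} (ψ : Vec n → EReal) (z : Vec n) : Set (Vec n) := epsSubdiff 0 ψ z

/-- The affine approximation `z ↦ ψ(w) + ⟨∇ψ(w), z - w⟩` of `ψ` at `w`. -/
def affApprox {n : ℕ} (ψ : Vec n → ℝ) (z w : Vec n) : ℝ :=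
  ψ w + inner ℝ (gradient ψ w) (z - w)

/-- A global minimizer of `F`. It is only used for proper closed strongly convex functions,
which have exactly one. -/
def argmin {n : ℕ} (F : Vec n → EReal) : Vec n :=
  Classical.epsilon fun y => ∀ y', F y ≤ F y'

/-! ### The accelerated composite gradient (ACG) method -/

/-- The quantities `(A_j, Γ_j, x_j, y_j)` carried from one ACG iteration to the next. -/
structure ACGState (n : ℕ) where
  A : ℝ
  Γ : Vec n → ℝ
  x : Vec n
  y : Vec n

/-- The input of the ACG method for minimizing `ψs + ψn`, where `ψn` is `μ`-strongly convex and
`ψs` has upper curvature `L`, started from `x0`. -/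
structure ACGInput (n : ℕ) where
  ψs : Vec n → ℝ
  ψn : Vec n → EReal
  μ : ℝ
  L : ℝ
  x0 : Vec n

/-- One iteration of the ACG method. -/
def ACGInput.step {n : ℕ} (I : ACGInput n) (s : ACGState n) : ACGState n :=
  let A' : ℝ := s.A + (I.μ * s.A + 1 +
    Real.sqrt ((I.μ * s.A + 1) ^ 2 + 4 * I.L * (I.μ * s.A + 1) * s.A)) / (2 * I.L)
  let xt : Vec n := (s.A / A') • s.x + ((A' - s.A) / A') • s.y
  let Γ' : Vec n → ℝ := fun z => s.A / A' * s.Γ z + (A' - s.A) / A' * affApprox I.ψs z xt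
  let y' : Vec n := argmin fun y =>
    ((Γ' y : ℝ) : EReal) + I.ψn y + ((1 / (2 * A') * ‖y - I.x0‖ ^ 2 : ℝ) : EReal)
  { A := A'
    Γ := Γ'
    x := (s.A / A') • s.x + ((A' - s.A) / A') • y'
    y := y' }

/-- The state of the ACG method after `j` iterations. -/
def ACGInput.iter {n : ℕ} (I : ACGInput n) : ℕ → ACGState n
  | 0 => { A := 0, Γ := fun _ => 0, x := I.x0, y := I.x0 }
  | j + 1 => I.step (I.iter j)

/-- The iterate `x_j`. -/
def ACGInput.x {n : ℕ} (I : ACGInput n) (j : ℕ) : Vec n := (I.iter j).x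

/-- The residual `u_j = (y_0 - y_j) / A_j`. -/
def ACGInput.u {n : ℕ} (I : ACGInput n) (j : ℕ) : Vec n :=
  (1 / (I.iter j).A) • (I.x0 - (I.iter j).y)

/-- The residual `η_j = (ψs + ψn)(x_j) - Γ_j(y_j) - ψn(y_j) - ⟨u_j, x_j - y_j⟩`. -/
def ACGInput.η {n : ℕ} (I : ACGInput n) (j : ℕ) : ℝ :=
  (I.ψs (I.iter j).x + (I.ψn (I.iter j).x).toReal) - (I.iter j).Γ (I.iter j).y
    - (I.ψn (I.iter j).y).toReal - inner ℝ (I.u j) ((I.iter j).x - (I.iter j).y)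

/-! ### The accelerated inexact proximal point (AIPP) method -/

/-- The input of the AIPP method for minimizing `g + h`, except for its initial point:
`M` is the upper curvature of `g`, `lam` the prox stepsize, `(ρ, ε)` the tolerance pair. -/
structure AIPPInput (n : ℕ) where
  g : Vec n → ℝ
  h : Vec n → EReal
  M : ℝ
  σ : ℝ
  lam : ℝ
  ρ : ℝ
  ε : ℝ

/-- The ACG call made by the AIPP method with prox center `z`:
`ψs = λ g + ‖· - z‖² / 4`, `ψn = λ h + ‖· - z‖² / 4`, `μ = 1 / 2`, `L = λ M + 1 / 2`. -/
def AIPPInput.acg {n : ℕ} (I : AIPPInput n) (z : Vec n) : ACGInput n where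
  ψs := fun x => I.lam * I.g x + 1 / 4 * ‖x - z‖ ^ 2
  ψn := fun x => (I.lam : EReal) * I.h x + ((1 / 4 * ‖x - z‖ ^ 2 : ℝ) : EReal)
  μ := 1 / 2
  L := I.lam * I.M + 1 / 2
  x0 := z

/-- The triple `(x, u, η)` is a `σ`-approximate solution of the prox subproblem with center `z`:
`η ≥ 0`, `u ∈ ∂_η (λ (g + h) + ‖· - z‖² / 2) (x)` and `‖u‖² + 2 η ≤ σ ‖z - x + u‖²`. -/
def AIPPInput.IsProxApprox {n : ℕ} (I : AIPPInput n) (z x u : Vec n) (η : ℝ) : Prop :=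
  0 ≤ η ∧
  u ∈ epsSubdiff η (fun w => (I.lam : EReal) * ((I.g w : EReal) + I.h w)
    + ((1 / 2 * ‖w - z‖ ^ 2 : ℝ) : EReal)) x ∧
  ‖u‖ ^ 2 + 2 * η ≤ I.σ * ‖z - x + u‖ ^ 2

/-- `j` is the number of ACG iterations made in step 1 of the AIPP method with prox center `z`:
the first `j ≥ ⌈6 √(2 λ M + 1)⌉` at which the ACG iterate is a `σ`-approximate solution. -/
def AIPPInput.IsStepOne {n : ℕ} (I : AIPPInput n) (z : Vec n) (j : ℕ) : Prop :=
  IsLeast {i : ℕ | ⌈6 * Real.sqrt (2 * I.lam * I.M + 1)⌉₊ ≤ i ∧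
    I.IsProxApprox z ((I.acg z).x i) ((I.acg z).u i) ((I.acg z).η i)} j

/-- When step 1 ended at ACG iteration `j`, the same ACG call is continued in step 3 up to its
`j'`-th iteration, the first one that is a `σ`-approximate solution with `η / λ ≤ ε`. -/
def AIPPInput.IsStepThree {n : ℕ} (I : AIPPInput n) (z : Vec n) (j j' : ℕ) : Prop :=
  IsLeast {i : ℕ | j ≤ i ∧
    I.IsProxApprox z ((I.acg z).x i) ((I.acg z).u i) ((I.acg z).η i) ∧
    (I.acg z).η i / I.lam ≤ I.ε} j'

/-- The output `(z⁻, z, w, ε)` of the AIPP method. -/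
structure AIPPOutput (n : ℕ) where
  zprev : Vec n
  z : Vec n
  w : Vec n
  ε : ℝ

/-- `I.Run z out N`: the AIPP method started from `z` terminates with output `out` after a total
of `N` ACG iterations. The method is deterministic: it has at most one run from `z`, and one exactly
if it terminates. -/
inductive AIPPInput.Run {n : ℕ} (I : AIPPInput n) : Vec n → AIPPOutput n → ℕ → Prop
  | last (z : Vec n) (j j' : ℕ) (h1 : I.IsStepOne z j)
      (h2 : ‖z - (I.acg z).x j + (I.acg z).u j‖ ≤ I.lam * I.ρ / 5)
      (h3 : I.IsStepThree z j j') :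
      AIPPInput.Run I z
        { zprev := z
          z := (I.acg z).x j'
          w := (1 / I.lam) • (I.acg z).u j'
          ε := (I.acg z).η j' / I.lam } j'
  | next (z : Vec n) (j : ℕ) (out : AIPPOutput n) (N : ℕ) (h1 : I.IsStepOne z j)
      (h2 : I.lam * I.ρ / 5 < ‖z - (I.acg z).x j + (I.acg z).u j‖)
      (h3 : AIPPInput.Run I ((I.acg z).x j) out N) :
      AIPPInput.Run I z out (j + N)

/-- The composite gradient step from `z` with curvature constant `M + λ⁻¹`. -/
def AIPPInput.zg {n : ℕ} (I : AIPPInput n) (z : Vec n) : Vec n :=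
  argmin fun u => (affApprox I.g u z : EReal) + I.h u
    + (((I.M + I.lam⁻¹) / 2 * ‖u - z‖ ^ 2 : ℝ) : EReal)

/-- The vector `v_g = (M + λ⁻¹) (z - z_g) + ∇g(z_g) - ∇g(z)`. -/
def AIPPInput.vg {n : ℕ} (I : AIPPInput n) (z : Vec n) : Vec n :=
  (I.M + I.lam⁻¹) • (z - I.zg z) + gradient I.g (I.zg z) - gradient I.g z

/-! ### The linearly constrained problem and the QP-AIPP method -/

/-- The data of the problem `min {f(z) + h(z) : A z = b}`, with the curvature constants `Lf`, `mf`
of `f` and the penalty parameter `chat`. -/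
structure Problem (n l : ℕ) where
  f : Vec n → ℝ
  h : Vec n → EReal
  A : Vec n →L[ℝ] Vec l
  b : Vec l
  Lf : ℝ
  mf : ℝ
  chat : ℝ

/-- The feasible set `{z ∈ dom h : A z = b}`. -/
def Problem.feasible {n l : ℕ} (P : Problem n l) : Set (Vec n) :=
  {z | z ∈ effDom P.h ∧ P.A z = P.b}

/-- The smooth part `g_c = f + (c / 2) ‖A · - b‖²` of the penalized objective. -/
def Problem.g {n l : ℕ} (P : Problem n l) (c : ℝ) (z : Vec n) : ℝ :=
  P.f z + c / 2 * ‖P.A z - P.b‖ ^ 2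

/-- The penalized objective `φ_c = f + h + (c / 2) ‖A · - b‖²`. -/
def Problem.φ {n l : ℕ} (P : Problem n l) (c : ℝ) (z : Vec n) : EReal :=
  (P.f z : EReal) + P.h z + ((c / 2 * ‖P.A z - P.b‖ ^ 2 : ℝ) : EReal)

/-- The optimal value of the penalized problem. -/
def Problem.φstar {n l : ℕ} (P : Problem n l) (c : ℝ) : EReal := ⨅ z, P.φ c z

/-- The standing assumptions (C1), (C2), (C3). -/
structure Problem.Assumptions {n l : ℕ} (P : Problem n l) : Prop where
  h_conv : IsProperClosedConvex P.h
  A_ne_zero : P.A ≠ 0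
  feasible_nonempty : P.feasible.Nonempty
  f_diff : ∀ z ∈ effDom P.h, DifferentiableAt ℝ P.f z
  mf_pos : 0 < P.mf
  mf_le_Lf : P.mf ≤ P.Lf
  f_lip : ∀ u ∈ effDom P.h, ∀ z ∈ effDom P.h,
    ‖gradient P.f z - gradient P.f u‖ ≤ P.Lf * ‖z - u‖
  f_lower : ∀ u ∈ effDom P.h, ∀ z ∈ effDom P.h,
    -P.mf / 2 * ‖u - z‖ ^ 2 + affApprox P.f u z ≤ P.f u
  chat_nonneg : 0 ≤ P.chat
  bdd_below : ⊥ < P.φstar P.chat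

/-- `R_c(λ) = inf {‖z0 - u‖² / 2 + (1 - σ) λ [φ_c(u) - inf φ_c] : u feasible}`. Under the standing
assumptions and for `c ≥ chat`, both `φ_c(u)` and `inf φ_c` are finite here. -/
def Problem.R {n l : ℕ} (P : Problem n l) (σ : ℝ) (z0 : Vec n) (c lam : ℝ) : ℝ :=
  ⨅ u : P.feasible, (1 / 2 * ‖z0 - u‖ ^ 2
    + (1 - σ) * lam * ((P.φ c u).toReal - (P.φstar c).toReal))

/-- The prox stepsize `λ = 1 / (2 m_f)`. -/
def Problem.lam {n l : ℕ} (P : Problem n l) : ℝ := 1 / (2 * P.mf)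

/-- The threshold `T = 2 R_chat(λ) / (η² (1 - σ) λ) + chat` on the penalty parameter. -/
def Problem.T {n l : ℕ} (P : Problem n l) (σ : ℝ) (z0 : Vec n) (η : ℝ) : ℝ :=
  2 * P.R σ z0 P.chat P.lam / (η ^ 2 * (1 - σ) * P.lam) + P.chat

/-- The ratio `Θ = (L_f + T ‖A‖²) / m_f`. -/
def Problem.Θ {n l : ℕ} (P : Problem n l) (σ : ℝ) (z0 : Vec n) (η : ℝ) : ℝ :=
  (P.Lf + P.T σ z0 η * ‖P.A‖ ^ 2) / P.mf

/-- The AIPP call of the QP-AIPP method with penalty parameter `c`: it is applied to `g_c + h` with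
`M = L_f + c ‖A‖²`, `λ = 1 / (2 m_f)` and the tolerances `ρ / 4`, `ρ² / (32 (M + 2 m_f))`. -/
def Problem.aipp {n l : ℕ} (P : Problem n l) (σ ρ c : ℝ) : AIPPInput n where
  g := P.g c
  h := P.h
  M := P.Lf + c * ‖P.A‖ ^ 2
  σ := σ
  lam := P.lam
  ρ := ρ / 4
  ε := ρ ^ 2 / (32 * (P.Lf + c * ‖P.A‖ ^ 2 + 2 * P.mf))

/-- The output `(ẑ, v̂, p̂)` of the QP-AIPP method. -/
structure Output (n l : ℕ) where
  z : Vec n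
  v : Vec n
  p : Vec l

/-- `P.RunFrom σ ρ η z0 c out N`: the loops of the QP-AIPP method, entered with penalty
parameter `c`, terminate with output `out` after a total of `N` ACG iterations. -/
inductive Problem.RunFrom {n l : ℕ} (P : Problem n l) (σ ρ η : ℝ) (z0 : Vec n) :
    ℝ → Output n l → ℕ → Prop
  | last (c : ℝ) (o : AIPPOutput n) (N : ℕ) (h1 : (P.aipp σ ρ c).Run z0 o N)
      (h2 : ‖P.A ((P.aipp σ ρ c).zg o.z) - P.b‖ ≤ η) :
      Problem.RunFrom P σ ρ η z0 c
        { z := (P.aipp σ ρ c).zg o.z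
          v := (P.aipp σ ρ c).vg o.z
          p := c • (P.A ((P.aipp σ ρ c).zg o.z) - P.b) } N
  | next (c : ℝ) (o : AIPPOutput n) (N : ℕ) (out : Output n l) (N' : ℕ)
      (h1 : (P.aipp σ ρ c).Run z0 o N)
      (h2 : η < ‖P.A ((P.aipp σ ρ c).zg o.z) - P.b‖)
      (h3 : Problem.RunFrom P σ ρ η z0 (2 * c) out N') :
      Problem.RunFrom P σ ρ η z0 c out (N + N')

/-- `P.Run σ ρ η z0 out N`: the QP-AIPP method with parameter `σ` and tolerances `(ρ, η)`, started
from `z0`, terminates with output `out` after a total of `N` ACG iterations. Its first penalty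
parameter is `chat + L_f / ‖A‖²`. -/
def Problem.Run {n l : ℕ} (P : Problem n l) (σ ρ η : ℝ) (z0 : Vec n) (out : Output n l) (N : ℕ) :
    Prop :=
  P.RunFrom σ ρ η z0 (P.chat + P.Lf / ‖P.A‖ ^ 2) out N

/-- `(ρ, η)`-approximate solutions: `v ∈ ∇f(z) + ∂h(z) + A* p`, `‖v‖ ≤ ρ`, `‖A z - b‖ ≤ η`. -/
def Problem.IsApproxSolution {n l : ℕ} (P : Problem n l) (ρ η : ℝ) (out : Output n l) : Prop :=
  (∃ s ∈ subdiff P.h out.z,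
    out.v = gradient P.f out.z + s + ContinuousLinearMap.adjoint P.A out.p) ∧
  ‖out.v‖ ≤ ρ ∧ ‖P.A out.z - P.b‖ ≤ η

end QPAIPP

end

namespace QPAIPP

open scoped RealInnerProductSpace

variable {n : ℕ}

/-! The proof has three levels, one for each loop.

Innermost: since `λ = 1 / (2 m_f)`, adding a quarter of a squared distance makes `λ g_c` convex, so
each prox subproblem is a convex composite problem with modulus `1/2` and curvature `L = λ M + 1/2`.
An estimate sequence (`ACGInput.Invariant`) shows that the weights `A_j` of the ACG method grow like
`j² / (4 L)` and eventually geometrically. The residuals `u_j` and `η_j` are of order `1 / A_j`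
relative to `‖x_j - z‖` and its square. Hence `O(√(L / σ))` iterations give a `σ`-approximate prox
point, and `O(√L log L)` iterations bring `A_j` up to `L`. The latter suffices for the tolerance on
`η`, because that tolerance is itself of order `ρ² / L`; so no logarithm of `1 / ρ` appears.

Middle: every outer AIPP iteration but the last lowers `λ (g + h)` by a fixed amount of order `(1 -
σ) (λ ρ)²` (`val_descent`), so their number is bounded by an objective gap. The gap at `z0` may grow
with `c`, as `z0` need not be feasible. But after a single approximate prox step the value is
compared with feasible points (`val_gap_le`), where the penalty vanishes, so the gap is at most `R /
(1 - σ)` for every `c ≥ chat`. The first outer iteration is therefore counted separately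
(`run_le_of_gap`).

Outermost: the gradient step from the AIPP output does not raise the penalized value. If its result
violates the constraint by more than `η`, the gap bound forces `c ≤ T` (`le_T_of_infeasible`), so
doubling stops soon after `c` exceeds `T`. One call costs a multiple of `√(c ‖A‖² / m_f)`, and these
costs form a geometric sum dominated by `√Θ` (`runFrom_spec`). When the test succeeds, optimality of
the gradient step gives the inclusion, and the accuracy of the last prox point gives `‖v‖ ≤ ρ`
(`zg_dist_le`). The bounds in the tolerances alone follow from `Θ = O(1 / η²)`. -/

theorem norm_sq_combo_sub (x y z : Vec n) {a b : ℝ} (hab : a + b = 1) :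
    ‖a • x + b • y - z‖ ^ 2 = a * ‖x - z‖ ^ 2 + b * ‖y - z‖ ^ 2 - a * b * ‖x - y‖ ^ 2 := by
  have h1 : a • x + b • y - z = a • (x - z) + b • (y - z) := by
    have : z = (a + b) • z := by rw [hab, one_smul]
    rw [smul_sub, smul_sub]
    nth_rewrite 1 [this]
    rw [add_smul]; abel
  have h2 : x - y = (x - z) - (y - z) := by abel
  rw [h1, h2, norm_add_sq_real, norm_sub_sq_real (x - z), norm_smul, norm_smul, mul_pow, mul_pow,
    Real.norm_eq_abs, Real.norm_eq_abs, sq_abs, sq_abs, inner_smul_left, inner_smul_right]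
  obtain rfl : b = 1 - a := by linarith
  simp only [conj_trivial]
  ring

/-- `‖u - y‖² - ‖y' - y‖² - ‖u - y'‖²` as an inner product. -/
theorem norm_sq_three_points (u y y' : Vec n) :
    ‖u - y‖ ^ 2 = ‖y' - y‖ ^ 2 + ‖u - y'‖ ^ 2 + 2 * ⟪y' - y, u - y'⟫ := by
  have : u - y = (y' - y) + (u - y') := by abel
  rw [this, norm_add_sq_real]; ring

/-! ### Proper closed convex functions: lower bounds, minimizers, quadratic perturbations -/

section Basic

variable {ψ : Vec n → EReal}

theorem IsProperClosedConvex.coe_toReal (hψ : IsProperClosedConvex ψ) {x : Vec n}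
    (hx : x ∈ effDom ψ) : (((ψ x).toReal : ℝ) : EReal) = ψ x :=
  EReal.coe_toReal (ne_of_lt hx) (hψ.ne_bot x)

theorem eq_top_of_notMem_effDom {x : Vec n} (hx : x ∉ effDom ψ) : ψ x = ⊤ := by
  simpa [effDom] using hx

theorem IsProperClosedConvex.convexOn (hψ : IsProperClosedConvex ψ) :
    ConvexOn ℝ (effDom ψ) (fun x => (ψ x).toReal) := by
  have key : ∀ x ∈ effDom ψ, ∀ y ∈ effDom ψ, ∀ a b : ℝ, 0 ≤ a → 0 ≤ b → a + b = 1 →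
      ψ (a • x + b • y) ≤ ((a * (ψ x).toReal + b * (ψ y).toReal : ℝ) : EReal) := by
    intro x hx y hy a b ha hb hab
    obtain rfl : b = 1 - a := by linarith
    have := hψ.convex x hx y hy a ⟨ha, by linarith⟩
    rw [← hψ.coe_toReal hx, ← hψ.coe_toReal hy] at this
    exact_mod_cast this
  have hmem : ∀ x ∈ effDom ψ, ∀ y ∈ effDom ψ, ∀ a b : ℝ, 0 ≤ a → 0 ≤ b → a + b = 1 →
      a • x + b • y ∈ effDom ψ := fun x hx y hy a b ha hb hab =>
    (key x hx y hy a b ha hb hab).trans_lt (EReal.coe_lt_top _)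
  refine ⟨fun x hx y hy a b ha hb hab => hmem x hx y hy a b ha hb hab,
    fun x hx y hy a b ha hb hab => ?_⟩
  have := key x hx y hy a b ha hb hab
  rw [← hψ.coe_toReal (hmem x hx y hy a b ha hb hab)] at this
  exact_mod_cast this

/-- A proper closed convex function decreases at most linearly. -/
theorem IsProperClosedConvex.exists_linear_lower_bound (hψ : IsProperClosedConvex ψ)
    {w : Vec n} (hw : w ∈ effDom ψ) :
    ∃ C : ℝ, 0 ≤ C ∧ ∀ x ∈ effDom ψ, -C * (1 + ‖x - w‖) ≤ (ψ x).toReal := by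
  obtain ⟨m, hm⟩ : ∃ m : ℝ, ∀ x ∈ Metric.closedBall w 1, x ∈ effDom ψ → m ≤ (ψ x).toReal := by
    obtain ⟨a, ha, hmin⟩ := LowerSemicontinuousOn.exists_isMinOn
      (⟨w, Metric.mem_closedBall_self zero_le_one⟩ : (Metric.closedBall w 1).Nonempty)
      (isCompact_closedBall w 1) (hψ.lsc.lowerSemicontinuousOn _)
    refine ⟨(ψ a).toReal, fun x hx hxd => ?_⟩
    exact EReal.toReal_le_toReal (hmin hx) (hψ.ne_bot a) (ne_of_lt hxd)
  have hC : ∃ C : ℝ, 0 ≤ C ∧ -C ≤ m ∧ -C ≤ m - (ψ w).toReal ∧ -C ≤ (ψ w).toReal :=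
    ⟨|m| + |(ψ w).toReal|, by positivity, by linarith [neg_abs_le m, abs_nonneg (ψ w).toReal],
      by linarith [neg_abs_le m, le_abs_self (ψ w).toReal],
      by linarith [abs_nonneg m, neg_abs_le (ψ w).toReal]⟩
  obtain ⟨C, hC0, hC1, hC2, hC3⟩ := hC
  refine ⟨C, hC0, fun x hx => ?_⟩
  rcases le_or_gt ‖x - w‖ 1 with h | h
  · have := hm x (by simpa [dist_eq_norm] using h) hx
    nlinarith [norm_nonneg (x - w)]
  -- Far from `w`, the point of the segment from `w` to `x` at distance one from `w` has value at
  -- least `m`; convexity along the segment carries this bound out to `x`, with loss linear in `t`.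
  · set t := ‖x - w‖ with ht
    have ht0 : 0 < t := by linarith
    have hti : 0 ≤ t⁻¹ := by positivity
    have hti1 : t⁻¹ ≤ 1 := inv_le_one_of_one_le₀ h.le
    have hp : t⁻¹ • x + (1 - t⁻¹) • w = w + t⁻¹ • (x - w) := by
      rw [sub_smul, smul_sub, one_smul]; abel
    have hin : t⁻¹ • x + (1 - t⁻¹) • w ∈ Metric.closedBall w 1 := by
      rw [hp, mem_closedBall_iff_norm, add_sub_cancel_left, norm_smul, Real.norm_eq_abs,
        abs_of_nonneg hti, ← ht, inv_mul_cancel₀ ht0.ne']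
    have hd := hψ.convexOn.1 hx hw hti (by linarith : 0 ≤ 1 - t⁻¹) (by ring)
    have h1 := hm _ hin hd
    have h2 := hψ.convexOn.2 hx hw hti (by linarith : 0 ≤ 1 - t⁻¹) (by ring)
    simp only [smul_eq_mul] at h2
    have h3 : t * m ≤ (ψ x).toReal + (t - 1) * (ψ w).toReal := by
      have := mul_le_mul_of_nonneg_left (h1.trans h2) ht0.le
      have e : t * (t⁻¹ * (ψ x).toReal + (1 - t⁻¹) * (ψ w).toReal)
          = (ψ x).toReal + (t - 1) * (ψ w).toReal := by
        field_simp
      linarith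
    nlinarith

theorem quad_combo (v w : Vec n) (α τ : ℝ) (x y : Vec n) {a b : ℝ} (hab : a + b = 1) :
    α + ⟪v, a • x + b • y⟫ + τ / 2 * ‖a • x + b • y - w‖ ^ 2
      = a * (α + ⟪v, x⟫ + τ / 2 * ‖x - w‖ ^ 2) + b * (α + ⟪v, y⟫ + τ / 2 * ‖y - w‖ ^ 2)
        - a * b * (τ / 2 * ‖x - y‖ ^ 2) := by
  rw [norm_sq_combo_sub x y w hab, inner_add_right, inner_smul_right, inner_smul_right]
  linear_combination (-α) * hab

/-- Existence of a minimizer of a proper closed convex function plus a strongly convex quadratic. -/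
theorem IsProperClosedConvex.exists_minimizer (hψ : IsProperClosedConvex ψ) (v w : Vec n)
    (α : ℝ) {τ : ℝ} (hτ : 0 < τ) :
    ∃ y, ∀ y', ψ y + ((α + ⟪v, y⟫ + τ / 2 * ‖y - w‖ ^ 2 : ℝ) : EReal)
      ≤ ψ y' + ((α + ⟪v, y'⟫ + τ / 2 * ‖y' - w‖ ^ 2 : ℝ) : EReal) := by
  set q : Vec n → ℝ := fun y => α + ⟪v, y⟫ + τ / 2 * ‖y - w‖ ^ 2 with hq
  change ∃ y, ∀ y', ψ y + ((q y : ℝ) : EReal) ≤ ψ y' + ((q y' : ℝ) : EReal)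
  have hqc : Continuous q := by fun_prop
  have hlsc : LowerSemicontinuous fun y => ψ y + ((q y : ℝ) : EReal) := by
    refine hψ.lsc.add' (continuous_coe_real_ereal.comp hqc).lowerSemicontinuous fun x => ?_
    exact EReal.continuousAt_add (Or.inr (EReal.coe_ne_bot _)) (Or.inr (EReal.coe_ne_top _))
  obtain ⟨p, hp⟩ := hψ.nonempty_dom
  obtain ⟨C, hC0, hC⟩ := hψ.exists_linear_lower_bound hp
  -- `B` collects the constant terms and `ρ` is where the quadratic overtakes the linear lower
  -- bounds: a point farther than `ρ` from `w` does worse than `p`. Minimizing over a closed ball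
  -- that also contains `p` is then enough.
  set B : ℝ := |(ψ p).toReal + q p| + |α| + C * (1 + ‖w - p‖) + ‖v‖ * ‖w‖ with hB
  have hB0 : 0 ≤ B := by positivity
  set ρ : ℝ := max 1 (2 * (B + C + ‖v‖) / τ) with hρ
  have hbd : ∀ y ∈ effDom ψ, (ψ y).toReal + q y ≤ (ψ p).toReal + q p → ‖y - w‖ ≤ ρ := by
    intro y hy hle
    by_contra! hgt
    have h1 : 1 < ‖y - w‖ := (le_max_left _ _).trans_lt hgt
    have h2 : 2 * (B + C + ‖v‖) / τ < ‖y - w‖ := (le_max_right _ _).trans_lt hgt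
    rw [div_lt_iff₀ hτ] at h2
    have h3 := hC y hy
    have h4 : ‖y - p‖ ≤ ‖y - w‖ + ‖w - p‖ := norm_sub_le_norm_sub_add_norm_sub y w p
    have h5 : -(‖v‖ * ‖y‖) ≤ ⟪v, y⟫ := (abs_le.1 (abs_real_inner_le_norm v y)).1
    have h6 : ‖y‖ ≤ ‖y - w‖ + ‖w‖ := by simpa using norm_add_le (y - w) w
    have h7 := mul_le_mul_of_nonneg_left h6 (norm_nonneg v)
    have h8 := mul_le_mul_of_nonneg_left h4 hC0
    have h9 : τ / 2 * ‖y - w‖ ^ 2 ≤ B + C * ‖y - w‖ + ‖v‖ * ‖y - w‖ := by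
      simp only [hq] at hle
      have := le_abs_self ((ψ p).toReal + q p)
      simp only [hq] at this
      simp only [hB, hq]
      nlinarith [neg_abs_le α]
    nlinarith [norm_nonneg v]
  set S : Set (Vec n) := Metric.closedBall w (max ρ ‖p - w‖) with hS
  obtain ⟨y, hyS, hy⟩ := LowerSemicontinuousOn.exists_isMinOn
    (⟨p, by simp [hS, dist_eq_norm]⟩ : S.Nonempty) (isCompact_closedBall _ _)
    (hlsc.lowerSemicontinuousOn S)
  refine ⟨y, fun y' => ?_⟩
  by_cases hy'S : y' ∈ S
  · exact hy hy'S
  · have hpS : p ∈ S := by simp [hS, dist_eq_norm]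
    refine (hy hpS).trans ?_
    by_cases hy' : y' ∈ effDom ψ
    · have hgt : ¬ ((ψ y').toReal + q y' ≤ (ψ p).toReal + q p) := fun hle => hy'S (by
        simp only [hS, mem_closedBall_iff_norm]
        exact (hbd y' hy' hle).trans (le_max_left _ _))
      change ψ p + ((q p : ℝ) : EReal) ≤ _
      rw [← hψ.coe_toReal hy', ← hψ.coe_toReal hp]
      exact_mod_cast (not_le.1 hgt).le
    · rw [eq_top_of_notMem_effDom hy']
      simp

/-- The minimizer of a strongly convex function plus a strongly convex quadratic, and its
quadratic growth. -/
theorem IsProperClosedConvex.argmin_spec (hψ : IsProperClosedConvex ψ) {μ : ℝ}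
    (hμ : StrongConvexOn (effDom ψ) μ (fun x => (ψ x).toReal)) (v w : Vec n) (α : ℝ) {τ : ℝ}
    (hτ : 0 < τ) {F : Vec n → EReal}
    (hF : ∀ y, F y = ψ y + ((α + ⟪v, y⟫ + τ / 2 * ‖y - w‖ ^ 2 : ℝ) : EReal)) :
    argmin F ∈ effDom ψ ∧ ∀ u ∈ effDom ψ,
      (ψ (argmin F)).toReal + (α + ⟪v, argmin F⟫ + τ / 2 * ‖argmin F - w‖ ^ 2)
        + (μ + τ) / 2 * ‖u - argmin F‖ ^ 2
      ≤ (ψ u).toReal + (α + ⟪v, u⟫ + τ / 2 * ‖u - w‖ ^ 2) := by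
  have hmin : ∀ y', F (argmin F) ≤ F y' := by
    refine Classical.epsilon_spec (p := fun y => ∀ y', F y ≤ F y') ?_
    obtain ⟨y, hy⟩ := hψ.exists_minimizer v w α hτ
    exact ⟨y, fun y' => by rw [hF, hF]; exact hy y'⟩
  set y := argmin F with hy
  have hyd : y ∈ effDom ψ := by
    obtain ⟨p, hp⟩ := hψ.nonempty_dom
    by_contra hyd
    have := hmin p
    rw [hF, hF, eq_top_of_notMem_effDom hyd, EReal.top_add_coe, ← hψ.coe_toReal hp,
      ← EReal.coe_add] at this
    exact absurd this (not_le.2 (EReal.coe_lt_top _))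
  refine ⟨hyd, fun u hu => ?_⟩
  have hG : ∀ z ∈ effDom ψ, (ψ y).toReal + (α + ⟪v, y⟫ + τ / 2 * ‖y - w‖ ^ 2)
      ≤ (ψ z).toReal + (α + ⟪v, z⟫ + τ / 2 * ‖z - w‖ ^ 2) := by
    intro z hz
    have := hmin z
    rw [hF, hF, ← hψ.coe_toReal hyd, ← hψ.coe_toReal hz] at this
    exact_mod_cast this
  -- Compare the minimizer with a point of the segment towards `u`, divide by `t`, then let `t` tend
  -- to zero to recover the full growth constant `μ + τ`.
  have key : ∀ t ∈ Set.Ioo (0 : ℝ) 1, (1 - t) * ((μ + τ) / 2 * ‖u - y‖ ^ 2)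
      ≤ (ψ u).toReal + (α + ⟪v, u⟫ + τ / 2 * ‖u - w‖ ^ 2)
        - ((ψ y).toReal + (α + ⟪v, y⟫ + τ / 2 * ‖y - w‖ ^ 2)) := by
    intro t ht
    have hab : t + (1 - t) = 1 := by ring
    have h0 := hμ.1 hu hyd ht.1.le (by linarith [ht.2] : 0 ≤ 1 - t) hab
    have h1 := hG _ h0
    have h2 := hμ.2 hu hyd ht.1.le (by linarith [ht.2] : 0 ≤ 1 - t) hab
    rw [quad_combo v w α τ u y hab] at h1
    simp only [smul_eq_mul] at h2
    refine le_of_mul_le_mul_left ?_ ht.1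
    nlinarith
  have hcont : Filter.Tendsto (fun t : ℝ => (1 - t) * ((μ + τ) / 2 * ‖u - y‖ ^ 2))
      (nhdsWithin 0 (Set.Ioi 0)) (nhds ((1 - 0) * ((μ + τ) / 2 * ‖u - y‖ ^ 2))) :=
    (Continuous.tendsto (by fun_prop) 0).mono_left nhdsWithin_le_nhds
  have := le_of_tendsto hcont (Filter.eventually_of_mem
    (Ioo_mem_nhdsGT (zero_lt_one' ℝ)) key)
  linarith

theorem coe_mul_add_coe_eq_top {lam : ℝ} (hlam : 0 < lam) {x : Vec n} (hx : x ∉ effDom ψ)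
    (r : ℝ) : (lam : EReal) * ψ x + (r : EReal) = ⊤ := by
  rw [eq_top_of_notMem_effDom hx, EReal.coe_mul_top_of_pos hlam, EReal.top_add_coe]

theorem IsProperClosedConvex.coe_mul_add_coe (hψ : IsProperClosedConvex ψ) (lam : ℝ) {x : Vec n}
    (hx : x ∈ effDom ψ) (r : ℝ) :
    (lam : EReal) * ψ x + (r : EReal) = ((lam * (ψ x).toReal + r : ℝ) : EReal) := by
  rw [← hψ.coe_toReal hx]
  norm_cast

theorem IsProperClosedConvex.toReal_coe_mul_add_coe (hψ : IsProperClosedConvex ψ) (lam : ℝ)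
    {x : Vec n} (hx : x ∈ effDom ψ) (r : ℝ) :
    ((lam : EReal) * ψ x + (r : EReal)).toReal = lam * (ψ x).toReal + r := by
  rw [hψ.coe_mul_add_coe lam hx, EReal.toReal_coe]

theorem IsProperClosedConvex.effDom_mul_add (hψ : IsProperClosedConvex ψ) {lam : ℝ}
    (hlam : 0 < lam) (q : Vec n → ℝ) :
    effDom (fun x => (lam : EReal) * ψ x + ((q x : ℝ) : EReal)) = effDom ψ := by
  ext x
  by_cases hx : x ∈ effDom ψ
  · simp only [hx, iff_true]
    change (lam : EReal) * ψ x + ((q x : ℝ) : EReal) < ⊤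
    rw [hψ.coe_mul_add_coe lam hx]
    exact EReal.coe_lt_top _
  · simp only [hx, iff_false]
    change ¬ ((lam : EReal) * ψ x + ((q x : ℝ) : EReal) < ⊤)
    rw [coe_mul_add_coe_eq_top hlam hx]
    simp

theorem IsProperClosedConvex.strongConvexOn_mul_add_sq (hψ : IsProperClosedConvex ψ) {lam : ℝ}
    (hlam : 0 < lam) (κ : ℝ) (z : Vec n) :
    StrongConvexOn (effDom ψ) κ
      (fun x => ((lam : EReal) * ψ x + ((κ / 2 * ‖x - z‖ ^ 2 : ℝ) : EReal)).toReal) := by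
  refine ⟨hψ.convexOn.1, fun x hx y hy a b ha hb hab => ?_⟩
  have hxy := hψ.convexOn.1 hx hy ha hb hab
  have h := hψ.convexOn.2 hx hy ha hb hab
  simp only [smul_eq_mul] at h ⊢
  rw [hψ.toReal_coe_mul_add_coe lam hx, hψ.toReal_coe_mul_add_coe lam hy,
    hψ.toReal_coe_mul_add_coe lam hxy, norm_sq_combo_sub x y z hab]
  nlinarith

theorem IsProperClosedConvex.mul_add_sq (hψ : IsProperClosedConvex ψ) {lam : ℝ}
    (hlam : 0 < lam) {κ : ℝ} (hκ : 0 ≤ κ) (z : Vec n) :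
    IsProperClosedConvex
      (fun x => (lam : EReal) * ψ x + ((κ / 2 * ‖x - z‖ ^ 2 : ℝ) : EReal)) := by
  have hd := hψ.effDom_mul_add hlam (fun x => κ / 2 * ‖x - z‖ ^ 2)
  refine ⟨fun x => ?_, by rw [hd]; exact hψ.nonempty_dom, ?_, ?_⟩
  · by_cases hx : x ∈ effDom ψ
    · rw [hψ.coe_mul_add_coe lam hx]; exact EReal.coe_ne_bot _
    · rw [coe_mul_add_coe_eq_top hlam hx]; simp
  · have h1 : LowerSemicontinuous fun x => (lam : EReal) * ψ x :=
      (continuous_iff_continuousAt.2 fun x => EReal.Tendsto.const_mul Filter.tendsto_id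
        (Or.inl (EReal.coe_ne_bot _)) (Or.inl (EReal.coe_ne_top _))).comp_lowerSemicontinuous hψ.lsc
        (fun a b hab => mul_le_mul_of_nonneg_left hab (by exact_mod_cast hlam.le))
    refine h1.add' (Continuous.lowerSemicontinuous
      (continuous_coe_real_ereal.comp (by fun_prop))) fun x => ?_
    exact EReal.continuousAt_add (Or.inr (EReal.coe_ne_bot _)) (Or.inr (EReal.coe_ne_top _))
  · rw [hd]
    intro x hx y hy a ha
    have hb : 0 ≤ 1 - a := by linarith [ha.2]
    have hab : a + (1 - a) = 1 := by ring
    have hxy := hψ.convexOn.1 hx hy ha.1 hb hab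
    have h := (hψ.strongConvexOn_mul_add_sq hlam κ z).2 hx hy ha.1 hb hab
    simp only [smul_eq_mul] at h
    rw [hψ.toReal_coe_mul_add_coe lam hx, hψ.toReal_coe_mul_add_coe lam hy,
      hψ.toReal_coe_mul_add_coe lam hxy] at h
    rw [hψ.coe_mul_add_coe lam hx, hψ.coe_mul_add_coe lam hy, hψ.coe_mul_add_coe lam hxy]
    have h' : 0 ≤ a * (1 - a) * (κ / 2 * ‖x - y‖ ^ 2) := by have := ha.1; positivity
    have h2 := h.trans (sub_le_self _ h')
    exact_mod_cast h2

end Basic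

/-- The descent lemma on a convex set. -/
theorem le_affApprox_add_of_lipschitz {f : Vec n → ℝ} {D : Set (Vec n)} (hD : Convex ℝ D)
    (hf : ∀ z ∈ D, DifferentiableAt ℝ f z) {L : ℝ}
    (hL : ∀ u ∈ D, ∀ z ∈ D, ‖gradient f z - gradient f u‖ ≤ L * ‖z - u‖)
    {u z : Vec n} (hu : u ∈ D) (hz : z ∈ D) :
    f u ≤ affApprox f u z + L / 2 * ‖u - z‖ ^ 2 := by
  have hmem : ∀ t ∈ Set.Icc (0 : ℝ) 1, z + t • (u - z) ∈ D := by
    intro t ht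
    have := hD hu hz ht.1 (by linarith [ht.2] : 0 ≤ 1 - t) (by ring)
    convert! this using 1
    rw [smul_sub, sub_smul, one_smul]; abel
  -- Along the segment, `f` minus its linear part minus the quadratic `L t² ‖u - z‖² / 2` has
  -- nonpositive derivative, by the Lipschitz bound between `z` and the moving point.
  have hder : ∀ t ∈ Set.Icc (0 : ℝ) 1, HasDerivAt
      (fun t : ℝ => f (z + t • (u - z)) - t * ⟪gradient f z, u - z⟫ - L / 2 * t ^ 2 * ‖u - z‖ ^ 2)
      (⟪gradient f (z + t • (u - z)), u - z⟫ - ⟪gradient f z, u - z⟫ - L * t * ‖u - z‖ ^ 2) t := by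
    intro t ht
    have h1 := (hf _ (hmem t ht)).hasGradientAt.hasFDerivAt
    have h2 : HasDerivAt (fun t : ℝ => z + t • (u - z)) (u - z) t := by
      simpa using ((hasDerivAt_id t).smul_const (u - z)).const_add z
    have h3 := h1.comp_hasDerivAt t h2
    have h4 := (hasDerivAt_id t).mul_const ⟪gradient f z, u - z⟫
    have h5 := (((hasDerivAt_id t).pow 2).const_mul (L / 2)).mul_const (‖u - z‖ ^ 2)
    convert! (h3.sub h4).sub h5 using 1
    simp only [id, InnerProductSpace.toDual_apply_apply]
    push_cast
    ring
  have hanti : AntitoneOn (fun t : ℝ =>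
      f (z + t • (u - z)) - t * ⟪gradient f z, u - z⟫ - L / 2 * t ^ 2 * ‖u - z‖ ^ 2)
      (Set.Icc (0 : ℝ) 1) := by
    refine antitoneOn_of_deriv_nonpos (convex_Icc 0 1)
      (fun t ht => (hder t ht).continuousAt.continuousWithinAt)
      (fun t ht => (hder t (interior_subset ht)).differentiableAt.differentiableWithinAt)
      fun t ht => ?_
    have ht' : t ∈ Set.Icc (0 : ℝ) 1 := interior_subset ht
    rw [(hder t ht').deriv, ← inner_sub_left]
    have h1 := real_inner_le_norm (gradient f (z + t • (u - z)) - gradient f z) (u - z)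
    have h2 := hL z hz _ (hmem t ht')
    rw [add_sub_cancel_left, norm_smul, Real.norm_eq_abs, abs_of_nonneg ht'.1] at h2
    have h3 := mul_le_mul_of_nonneg_right h2 (norm_nonneg (u - z))
    nlinarith
  have := hanti (Set.left_mem_Icc.2 zero_le_one) (Set.right_mem_Icc.2 zero_le_one) zero_le_one
  simp only [one_smul, zero_smul, add_zero, add_sub_cancel] at this
  unfold affApprox
  linarith

theorem affApprox_eq (ψ : Vec n → ℝ) (z w : Vec n) :
    affApprox ψ z w = (ψ w - ⟪gradient ψ w, w⟫) + ⟪gradient ψ w, z⟫ := by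
  unfold affApprox
  rw [inner_sub_right]; ring

/-! ### The ACG method: estimate sequence, growth of the weights, residuals -/

namespace ACGInput

/-- The assumptions on the input under which the ACG method is analysed. -/
structure Admissible (I : ACGInput n) : Prop where
  conv : IsProperClosedConvex I.ψn
  strong : StrongConvexOn (effDom I.ψn) I.μ (fun x => (I.ψn x).toReal)
  μ_nonneg : 0 ≤ I.μ
  L_pos : 0 < I.L
  x0_mem : I.x0 ∈ effDom I.ψn
  lower : ∀ z ∈ effDom I.ψn, ∀ w ∈ effDom I.ψn, affApprox I.ψs z w ≤ I.ψs z
  upper : ∀ z ∈ effDom I.ψn, ∀ w ∈ effDom I.ψn,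
    I.ψs z ≤ affApprox I.ψs z w + I.L / 2 * ‖z - w‖ ^ 2

/-- The objective `ψs + ψn` on the effective domain. -/
noncomputable def obj (I : ACGInput n) (w : Vec n) : ℝ := I.ψs w + (I.ψn w).toReal

/-- The increment `A_{j+1} - A_j` as a function of `A_j`. -/
noncomputable def stepsize (I : ACGInput n) (A : ℝ) : ℝ :=
  (I.μ * A + 1 + Real.sqrt ((I.μ * A + 1) ^ 2 + 4 * I.L * (I.μ * A + 1) * A)) / (2 * I.L)

/-- The estimate-sequence invariant of the ACG method. -/
structure Invariant (I : ACGInput n) (s : ACGState n) : Prop where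
  A_nonneg : 0 ≤ s.A
  x_mem : s.x ∈ effDom I.ψn
  y_mem : s.y ∈ effDom I.ψn
  affine : ∃ (α : ℝ) (v : Vec n), ∀ z, s.Γ z = α + ⟪v, z⟫
  minorant : ∀ z ∈ effDom I.ψn, s.A * s.Γ z ≤ s.A * I.ψs z
  est : s.A * I.obj s.x
    ≤ s.A * (s.Γ s.y + (I.ψn s.y).toReal) + 1 / 2 * ‖s.y - I.x0‖ ^ 2
  growth : ∀ w ∈ effDom I.ψn,
    s.A * (s.Γ s.y + (I.ψn s.y).toReal) + 1 / 2 * ‖s.y - I.x0‖ ^ 2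
        + (1 + I.μ * s.A) / 2 * ‖w - s.y‖ ^ 2
      ≤ s.A * (s.Γ w + (I.ψn w).toReal) + 1 / 2 * ‖w - I.x0‖ ^ 2

variable {I : ACGInput n}

theorem Admissible.stepsize_pos (hI : I.Admissible) {A : ℝ} (hA : 0 ≤ A) : 0 < I.stepsize A := by
  have h1 := mul_nonneg hI.μ_nonneg hA
  have h2 := hI.L_pos
  unfold stepsize
  positivity

/-- The increment is the positive root of this quadratic. The equation is the balance between
curvature and strong convexity on which the estimate sequence rests. -/
theorem Admissible.stepsize_sq (hI : I.Admissible) {A : ℝ} (hA : 0 ≤ A) :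
    I.L * I.stepsize A ^ 2 = (I.μ * A + 1) * (A + I.stepsize A) := by
  have h1 := mul_nonneg hI.μ_nonneg hA
  have h2 := hI.L_pos
  have h3 : 0 ≤ (I.μ * A + 1) ^ 2 + 4 * I.L * (I.μ * A + 1) * A := by positivity
  have h4 := Real.sq_sqrt h3
  unfold stepsize
  set r := Real.sqrt ((I.μ * A + 1) ^ 2 + 4 * I.L * (I.μ * A + 1) * A)
  field_simp
  linear_combination h4

theorem iter_succ_A (I : ACGInput n) (j : ℕ) :
    (I.iter (j + 1)).A = (I.iter j).A + I.stepsize (I.iter j).A := rfl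

theorem Admissible.invariant_zero (hI : I.Admissible) : I.Invariant (I.iter 0) where
  A_nonneg := le_rfl
  x_mem := hI.x0_mem
  y_mem := hI.x0_mem
  affine := ⟨0, 0, fun z => by simp [iter]⟩
  minorant := fun z _ => by simp [iter]
  est := by simp [iter]
  growth := fun w _ => by simp [iter]

/-- The old growth inequality at the new `y`, the old estimate, and linearization of `ψs` at the
extrapolated point are added with weights `A` and `a`. The only error is the curvature term of `ψs`
at the new `x`, and the growth term pays for it exactly. -/
theorem Admissible.invariant_step (hI : I.Admissible) {s : ACGState n} (hs : I.Invariant s) :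
    I.Invariant (I.step s) := by
  set a := I.stepsize s.A with ha
  have ha0 : 0 < a := hI.stepsize_pos hs.A_nonneg
  have hsq : I.L * a ^ 2 = (I.μ * s.A + 1) * (s.A + a) := hI.stepsize_sq hs.A_nonneg
  have hA := hs.A_nonneg
  have hA' : 0 < s.A + a := by linarith
  have e1 : s.A / (s.A + a) + (s.A + a - s.A) / (s.A + a) = 1 := by field_simp; ring
  have n1 : 0 ≤ s.A / (s.A + a) := by positivity
  have n2 : 0 ≤ (s.A + a - s.A) / (s.A + a) := by
    rw [add_sub_cancel_left]; positivity
  obtain ⟨α, v, hv⟩ := hs.affine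
  set xt : Vec n := (s.A / (s.A + a)) • s.x + ((s.A + a - s.A) / (s.A + a)) • s.y with hxt
  have hxtm : xt ∈ effDom I.ψn := hI.strong.1 hs.x_mem hs.y_mem n1 n2 e1
  set s' := I.step s with hs'
  have hsA : s'.A = s.A + a := rfl
  have hsΓ : ∀ z, s'.Γ z = s.A / (s.A + a) * s.Γ z
      + (s.A + a - s.A) / (s.A + a) * affApprox I.ψs z xt := fun z => rfl
  have hsx : s'.x = (s.A / (s.A + a)) • s.x + ((s.A + a - s.A) / (s.A + a)) • s'.y := rfl
  have hsy : s'.y = argmin fun y => ((s'.Γ y : ℝ) : EReal) + I.ψn y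
      + ((1 / (2 * (s.A + a)) * ‖y - I.x0‖ ^ 2 : ℝ) : EReal) := rfl
  have haff : ∃ (α : ℝ) (v : Vec n), ∀ z, s'.Γ z = α + ⟪v, z⟫ := by
    refine ⟨s.A / (s.A + a) * α + (s.A + a - s.A) / (s.A + a)
        * (I.ψs xt - ⟪gradient I.ψs xt, xt⟫),
      (s.A / (s.A + a)) • v + ((s.A + a - s.A) / (s.A + a)) • gradient I.ψs xt, fun z => ?_⟩
    rw [hsΓ, hv, affApprox_eq, inner_add_left, inner_smul_left, inner_smul_left]
    simp only [conj_trivial]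
    ring
  have hΓmul : ∀ z, (s.A + a) * s'.Γ z = s.A * s.Γ z + a * affApprox I.ψs z xt := by
    intro z
    rw [hsΓ]; field_simp; ring
  obtain ⟨α', v', hv'⟩ := haff
  have hspec := hI.conv.argmin_spec hI.strong v' I.x0 α' (τ := 1 / (s.A + a)) (by positivity)
    (F := fun y => ((s'.Γ y : ℝ) : EReal) + I.ψn y
      + ((1 / (2 * (s.A + a)) * ‖y - I.x0‖ ^ 2 : ℝ) : EReal)) (fun y => by
        rw [hv', add_comm ((α' + ⟪v', y⟫ : ℝ) : EReal), add_assoc, ← EReal.coe_add]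
        congr 3
        field_simp)
  rw [← hsy] at hspec
  obtain ⟨hym, hyg⟩ := hspec
  have hgrowth : ∀ w ∈ effDom I.ψn,
      (s.A + a) * (s'.Γ s'.y + (I.ψn s'.y).toReal) + 1 / 2 * ‖s'.y - I.x0‖ ^ 2
          + (1 + I.μ * (s.A + a)) / 2 * ‖w - s'.y‖ ^ 2
        ≤ (s.A + a) * (s'.Γ w + (I.ψn w).toReal) + 1 / 2 * ‖w - I.x0‖ ^ 2 := by
    intro w hw
    have h := mul_le_mul_of_nonneg_left (hyg w hw) hA'.le
    rw [hv', hv']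
    have c : (s.A + a) * (1 / (s.A + a)) = 1 := by field_simp
    have r1 : ∀ t : ℝ, (s.A + a) * (1 / (s.A + a) / 2 * t) = 1 / 2 * t := fun t => by
      linear_combination (t / 2) * c
    have r2 : (s.A + a) * ((I.μ + 1 / (s.A + a)) / 2 * ‖w - s'.y‖ ^ 2)
        = (1 + I.μ * (s.A + a)) / 2 * ‖w - s'.y‖ ^ 2 := by
      linear_combination (‖w - s'.y‖ ^ 2 / 2) * c
    have r3 := r1 (‖s'.y - I.x0‖ ^ 2)
    have r4 := r1 (‖w - I.x0‖ ^ 2)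
    linarith
  have hxm : s'.x ∈ effDom I.ψn := by
    rw [hsx]; exact hI.strong.1 hs.x_mem hym n1 n2 e1
  refine ⟨by rw [hsA]; exact hA'.le, hxm, hym, ⟨α', v', hv'⟩, fun z hz => ?_, ?_,
    fun w hw => by rw [hsA]; exact hgrowth w hw⟩
  · rw [hsA, hΓmul]
    have := hs.minorant z hz
    have := mul_le_mul_of_nonneg_left (hI.lower z hz xt hxtm) ha0.le
    linarith
  · rw [hsA]
    have hg := hs.growth _ hym
    have he := hs.est
    have hlow := mul_le_mul_of_nonneg_left (hI.lower _ hs.x_mem xt hxtm) hA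
    have hup := mul_le_mul_of_nonneg_left (hI.upper _ hxm xt hxtm) hA'.le
    have hp : (s.A + a) * (I.ψn s'.x).toReal
        ≤ s.A * (I.ψn s.x).toReal + a * (I.ψn s'.y).toReal := by
      have h := hI.strong.2 hs.x_mem hym n1 n2 e1
      simp only [smul_eq_mul] at h
      rw [← hsx] at h
      have h0 : 0 ≤ s.A / (s.A + a) * ((s.A + a - s.A) / (s.A + a))
          * (I.μ / 2 * ‖s.x - s'.y‖ ^ 2) := by have := hI.μ_nonneg; positivity
      have h1 := mul_le_mul_of_nonneg_left (h.trans (sub_le_self _ h0)) hA'.le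
      have e : (s.A + a) * (s.A / (s.A + a) * (I.ψn s.x).toReal
          + (s.A + a - s.A) / (s.A + a) * (I.ψn s'.y).toReal)
          = s.A * (I.ψn s.x).toReal + a * (I.ψn s'.y).toReal := by
        field_simp; ring
      linarith
    have hl : (s.A + a) * affApprox I.ψs s'.x xt
        = s.A * affApprox I.ψs s.x xt + a * affApprox I.ψs s'.y xt := by
      have hi : ∀ g : Vec n, ⟪g, s'.x⟫ = s.A / (s.A + a) * ⟪g, s.x⟫
          + (s.A + a - s.A) / (s.A + a) * ⟪g, s'.y⟫ := fun g => by
        rw [hsx, inner_add_right, inner_smul_right, inner_smul_right]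
      rw [affApprox_eq, affApprox_eq, affApprox_eq, hi]
      field_simp; ring
    -- The new `x` and the extrapolated point differ only in their `y` component, so the curvature
    -- error is a multiple of `‖s'.y - s.y‖²`; `stepsize_sq` identifies it with the available growth
    -- term.
    have hd : s'.x - xt = (a / (s.A + a)) • (s'.y - s.y) := by
      rw [hsx, hxt, add_sub_cancel_left, smul_sub]; abel
    have hn : (s.A + a) * (I.L / 2 * ‖s'.x - xt‖ ^ 2)
        = (1 + I.μ * s.A) / 2 * ‖s'.y - s.y‖ ^ 2 := by
      rw [hd, norm_smul, Real.norm_eq_abs, mul_pow, sq_abs]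
      field_simp
      linear_combination ‖s'.y - s.y‖ ^ 2 * hsq
    have hΓy := hΓmul s'.y
    unfold obj at he ⊢
    linarith

theorem Admissible.invariant (hI : I.Admissible) (j : ℕ) : I.Invariant (I.iter j) := by
  induction j with
  | zero => exact hI.invariant_zero
  | succ j ih => exact hI.invariant_step ih

theorem Admissible.A_nonneg (hI : I.Admissible) (j : ℕ) : 0 ≤ (I.iter j).A :=
  (hI.invariant j).A_nonneg

theorem Admissible.A_pos (hI : I.Admissible) {j : ℕ} (hj : 1 ≤ j) : 0 < (I.iter j).A := by
  obtain ⟨k, rfl⟩ : ∃ k, j = k + 1 := ⟨j - 1, by omega⟩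
  rw [iter_succ_A]
  linarith [hI.A_nonneg k, hI.stepsize_pos (hI.A_nonneg k)]

theorem Admissible.A_mono (hI : I.Admissible) : Monotone fun j => (I.iter j).A :=
  monotone_nat_of_le_succ fun j => by
    rw [iter_succ_A]
    linarith [hI.stepsize_pos (hI.A_nonneg j)]

/-- By `stepsize_sq` the increment is `r √A'` with `r = √((μ A + 1) / L)`. Dividing `A' - A = (√A' -
√A)(√A' + √A)` by `√A' + √A ≤ 2 √A'` leaves a gain of at least `r / 2`. -/
theorem Admissible.sqrt_A_succ (hI : I.Admissible) (j : ℕ) :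
    √(I.iter j).A + 1 / 2 * √((I.μ * (I.iter j).A + 1) / I.L) ≤ √(I.iter (j + 1)).A := by
  have hA := hI.A_nonneg j
  have hA' := hI.A_pos (Nat.le_add_left 1 j)
  have ha := hI.stepsize_pos hA
  have hsq := hI.stepsize_sq hA
  rw [← iter_succ_A] at hsq
  have hE := iter_succ_A I j
  set A := (I.iter j).A
  set A' := (I.iter (j + 1)).A
  set a := I.stepsize A
  have hL := hI.L_pos
  have hμ := mul_nonneg hI.μ_nonneg hA
  set r := √((I.μ * A + 1) / I.L)
  have hr0 : 0 ≤ r := Real.sqrt_nonneg _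
  have hr : r ^ 2 = (I.μ * A + 1) / I.L := Real.sq_sqrt (by positivity)
  have hs : √A ^ 2 = A := Real.sq_sqrt hA
  have hs' : √A' ^ 2 = A' := Real.sq_sqrt hA'.le
  have hp := Real.sqrt_nonneg A
  have hp' := Real.sqrt_pos.2 hA'
  have hle : √A ≤ √A' := Real.sqrt_le_sqrt (by linarith)
  have har : a = r * √A' := by
    have : a ^ 2 = (r * √A') ^ 2 := by
      rw [mul_pow, hr, hs']; field_simp; linarith
    exact (pow_left_inj₀ ha.le (by positivity) two_ne_zero).1 this
  have h1 : (√A' - √A) * (√A' + √A) = r * √A' := by nlinarith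
  by_contra! hcon
  have h2 : (√A' - √A) * (√A' + √A) ≤ (√A' - √A) * (2 * √A') :=
    mul_le_mul_of_nonneg_left (by linarith) (by linarith)
  nlinarith

theorem Admissible.sqrt_A_ge_linear (hI : I.Admissible) (j : ℕ) :
    j / (2 * √I.L) ≤ √(I.iter j).A := by
  have hL := Real.sqrt_pos.2 hI.L_pos
  induction j with
  | zero => simp
  | succ j ih =>
    refine le_trans ?_ (hI.sqrt_A_succ j)
    have hμ := mul_nonneg hI.μ_nonneg (hI.A_nonneg j)
    have h1 : √(1 / I.L) ≤ √((I.μ * (I.iter j).A + 1) / I.L) := by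
      apply Real.sqrt_le_sqrt
      have := hI.L_pos
      gcongr
      linarith
    rw [Real.sqrt_div zero_le_one, Real.sqrt_one] at h1
    have h2 : ((j + 1 : ℕ) : ℝ) / (2 * √I.L) = j / (2 * √I.L) + 1 / 2 * (1 / √I.L) := by
      push_cast; field_simp
    linarith

theorem Admissible.A_ge_sq (hI : I.Admissible) (j : ℕ) :
    (j : ℝ) ^ 2 / (4 * I.L) ≤ (I.iter j).A := by
  have h := pow_le_pow_left₀ (by positivity) (hI.sqrt_A_ge_linear j) 2
  rw [Real.sq_sqrt (hI.A_nonneg j), div_pow, mul_pow, Real.sq_sqrt hI.L_pos.le] at h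
  norm_num at h ⊢
  exact h

/-- Dropping `1` instead of `μ A` from `μ A + 1` turns the additive gain of `sqrt_A_succ` into a
multiplicative one. The induction starts at the first iteration, since the weight is zero before it.
-/
theorem Admissible.sqrt_A_ge_pow (hI : I.Admissible) (j : ℕ) :
    (1 + 1 / 2 * √(I.μ / I.L)) ^ j / (2 * √I.L) ≤ √(I.iter (j + 1)).A := by
  have hL := Real.sqrt_pos.2 hI.L_pos
  induction j with
  | zero => simpa using hI.sqrt_A_ge_linear 1
  | succ j ih =>
    refine le_trans ?_ (hI.sqrt_A_succ (j + 1))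
    have h1 : √(I.μ / I.L) * √(I.iter (j + 1)).A
        ≤ √((I.μ * (I.iter (j + 1)).A + 1) / I.L) := by
      have := hI.L_pos
      rw [← Real.sqrt_mul (div_nonneg hI.μ_nonneg this.le)]
      apply Real.sqrt_le_sqrt
      rw [div_mul_eq_mul_div]
      gcongr
      linarith
    have h2 := mul_le_mul_of_nonneg_left ih
      (by positivity : 0 ≤ 1 + 1 / 2 * √(I.μ / I.L))
    have h3 : (1 + 1 / 2 * √(I.μ / I.L)) ^ (j + 1) / (2 * √I.L) = (1 + 1 / 2 * √(I.μ / I.L))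
        * ((1 + 1 / 2 * √(I.μ / I.L)) ^ j / (2 * √I.L)) := by rw [pow_succ]; ring
    rw [h3]
    linarith

/-- The residual pair `(u_j, η_j)` certifies an approximate solution. -/
theorem Admissible.obj_ge (hI : I.Admissible) {j : ℕ} (hj : 1 ≤ j) {w : Vec n}
    (hw : w ∈ effDom I.ψn) :
    I.obj (I.x j) + ⟪I.u j, w - I.x j⟫ - I.η j + I.μ / 2 * ‖w - (I.iter j).y‖ ^ 2 ≤ I.obj w := by
  have hA := hI.A_pos hj
  have hinv := hI.invariant j
  have hm := hinv.minorant w hw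
  have hg := hinv.growth w hw
  have h3 := norm_sq_three_points w I.x0 (I.iter j).y
  have hu : (I.iter j).A * ⟪I.u j, w - (I.iter j).y⟫
      = - ⟪(I.iter j).y - I.x0, w - (I.iter j).y⟫ := by
    unfold u
    rw [inner_smul_left, ← inner_neg_left, neg_sub]
    simp only [conj_trivial]
    field_simp
  have hs : ⟪I.u j, w - I.x j⟫
      = ⟪I.u j, w - (I.iter j).y⟫ - ⟪I.u j, I.x j - (I.iter j).y⟫ := by
    rw [← inner_sub_right]; congr 1; abel
  refine le_of_mul_le_mul_left ?_ hA
  unfold η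
  change _ ≤ (I.iter j).A * (I.ψs w + (I.ψn w).toReal)
  change (I.iter j).A * ((I.ψs (I.x j) + (I.ψn (I.x j)).toReal) + _
    - (_ - ⟪I.u j, I.x j - (I.iter j).y⟫) + _) ≤ _
  rw [hs]
  change (I.iter j).A * ((I.ψs (I.x j) + (I.ψn (I.x j)).toReal) + _
    - ((I.ψs (I.x j) + (I.ψn (I.x j)).toReal) - _ - _ - _) + _) ≤ _
  linarith

/-- This is the estimate part of the invariant, rewritten by completing the square with `A_j u_j =
x_0 - y_j`. -/
theorem Admissible.residual_le (hI : I.Admissible) {j : ℕ} (hj : 1 ≤ j) :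
    ‖I.x j - (I.iter j).y‖ ^ 2 + 2 * (I.iter j).A * I.η j ≤ ‖I.x j - I.x0‖ ^ 2 := by
  have hA := hI.A_pos hj
  have he := (hI.invariant j).est
  have h3 := norm_sq_three_points (I.x j) I.x0 (I.iter j).y
  have hu : (I.iter j).A * ⟪I.u j, I.x j - (I.iter j).y⟫
      = - ⟪(I.iter j).y - I.x0, I.x j - (I.iter j).y⟫ := by
    unfold u
    rw [inner_smul_left, ← inner_neg_left, neg_sub]
    simp only [conj_trivial]
    field_simp
  unfold η obj at *
  change (I.iter j).A * (I.ψs (I.x j) + (I.ψn (I.x j)).toReal) ≤ _ at he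
  change _ + 2 * (I.iter j).A * ((I.ψs (I.x j) + (I.ψn (I.x j)).toReal) - _ - _
    - ⟪I.u j, I.x j - (I.iter j).y⟫) ≤ _
  nlinarith

end ACGInput

/-- Here `w` may be another iterate of the same run; this is how early and late iterates are
compared in `acg_dist_le_dist`. -/
theorem ACGInput.Admissible.obj_le {I : ACGInput n} (hI : I.Admissible) (j : ℕ) {w : Vec n}
    (hw : w ∈ effDom I.ψn) :
    (I.iter j).A * I.obj (I.x j) + (1 + I.μ * (I.iter j).A) / 2 * ‖w - (I.iter j).y‖ ^ 2
      ≤ (I.iter j).A * I.obj w + 1 / 2 * ‖w - I.x0‖ ^ 2 := by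
  have hinv := hI.invariant j
  have hm := hinv.minorant w hw
  have hg := hinv.growth w hw
  have he : (I.iter j).A * I.obj (I.x j) ≤ _ := hinv.est
  have e : (I.iter j).A * I.obj w
      = (I.iter j).A * I.ψs w + (I.iter j).A * (I.ψn w).toReal := by unfold obj; ring
  linarith

theorem exists_isLeast_of_nonempty {S : Set ℕ} (hS : S.Nonempty) : ∃ j, IsLeast S j :=
  ⟨sInf S, Nat.sInf_mem hS, fun _ h => Nat.sInf_le h⟩

theorem hasGradientAt_mul_add_sq {g : Vec n → ℝ} {w : Vec n} (hg : DifferentiableAt ℝ g w)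
    (lam κ : ℝ) (z : Vec n) :
    HasGradientAt (fun x => lam * g x + κ * ‖x - z‖ ^ 2)
      (lam • gradient g w + (2 * κ) • (w - z)) w := by
  rw [hasGradientAt_iff_hasFDerivAt]
  have h1 := hg.hasGradientAt.hasFDerivAt.const_mul lam
  have h2 := (((hasFDerivAt_id w).sub_const z).norm_sq).const_mul κ
  convert! h1.add h2 using 1
  ext v
  simp
  ring

/-! ### The AIPP method: prox subproblems and their ACG iterates -/

namespace AIPPInput

/-- The assumptions on the input under which the AIPP method is analysed. -/
structure Regular (I : AIPPInput n) : Prop where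
  conv : IsProperClosedConvex I.h
  lam_pos : 0 < I.lam
  diff : ∀ z ∈ effDom I.h, DifferentiableAt ℝ I.g z
  lower : ∀ u ∈ effDom I.h, ∀ z ∈ effDom I.h,
    I.lam * affApprox I.g u z - 1 / 4 * ‖u - z‖ ^ 2 ≤ I.lam * I.g u
  upper : ∀ u ∈ effDom I.h, ∀ z ∈ effDom I.h,
    I.g u ≤ affApprox I.g u z + I.M / 2 * ‖u - z‖ ^ 2
  half_le : 1 / 2 ≤ I.lam * I.M
  σ_pos : 0 < I.σ
  σ_lt_one : I.σ < 1
  ρ_pos : 0 < I.ρ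
  tol : 9 * I.lam * I.ρ ^ 2 ≤ 50 * (I.lam * I.M + 1 / 2) * I.ε

/-- The objective `g + h` on the effective domain of `h`. -/
noncomputable def val (I : AIPPInput n) (w : Vec n) : ℝ := I.g w + (I.h w).toReal

/-- The upper curvature of the smooth part of the prox subproblems. -/
noncomputable def curv (I : AIPPInput n) : ℝ := I.lam * I.M + 1 / 2

variable {I : AIPPInput n}

theorem Regular.one_le_curv (hI : I.Regular) : 1 ≤ I.curv := by
  unfold curv; linarith [hI.half_le]

theorem acg_ψn_eq (I : AIPPInput n) (z : Vec n) : (I.acg z).ψn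
    = fun x => (I.lam : EReal) * I.h x + (((1 / 2 : ℝ) / 2 * ‖x - z‖ ^ 2 : ℝ) : EReal) := by
  unfold acg
  norm_num

theorem Regular.effDom_acg (hI : I.Regular) (z : Vec n) :
    effDom (I.acg z).ψn = effDom I.h := by
  rw [acg_ψn_eq]
  exact hI.conv.effDom_mul_add hI.lam_pos _

theorem affApprox_acg (I : AIPPInput n) (z : Vec n) {u w : Vec n}
    (hw : DifferentiableAt ℝ I.g w) :
    affApprox (I.acg z).ψs u w
      = I.lam * affApprox I.g u w + 1 / 4 * ‖u - z‖ ^ 2 - 1 / 4 * ‖u - w‖ ^ 2 := by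
  have hg : gradient (I.acg z).ψs w = I.lam • gradient I.g w + (2 * (1 / 4 : ℝ)) • (w - z) :=
    (hasGradientAt_mul_add_sq hw I.lam (1 / 4) z).gradient
  have h3 := norm_sq_three_points u z w
  unfold affApprox
  rw [hg, inner_add_left, inner_smul_left, inner_smul_left]
  change I.lam * I.g w + 1 / 4 * ‖w - z‖ ^ 2 + _ = _
  simp only [conj_trivial]
  linear_combination (-1 / 4) * h3

/-- Half of the prox term goes to each part: one quarter of the squared distance absorbs the
nonconvexity of `λ g`, the other makes `ψn` strongly convex with modulus `1/2`. -/
theorem Regular.acg_admissible (hI : I.Regular) {z : Vec n} (hz : z ∈ effDom I.h) :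
    (I.acg z).Admissible where
  conv := by
    rw [acg_ψn_eq]
    exact hI.conv.mul_add_sq hI.lam_pos (by norm_num) z
  strong := by
    rw [hI.effDom_acg, acg_ψn_eq]
    exact hI.conv.strongConvexOn_mul_add_sq hI.lam_pos (1 / 2) z
  μ_nonneg := by change (0 : ℝ) ≤ 1 / 2; norm_num
  L_pos := by
    change 0 < I.lam * I.M + 1 / 2
    linarith [hI.half_le]
  x0_mem := by rw [hI.effDom_acg]; exact hz
  lower := fun u hu w hw => by
    rw [hI.effDom_acg] at hu hw
    rw [affApprox_acg I z (hI.diff w hw)]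
    have := hI.lower u hu w hw
    change _ ≤ I.lam * I.g u + 1 / 4 * ‖u - z‖ ^ 2
    linarith
  upper := fun u hu w hw => by
    rw [hI.effDom_acg] at hu hw
    rw [affApprox_acg I z (hI.diff w hw)]
    have := mul_le_mul_of_nonneg_left (hI.upper u hu w hw) hI.lam_pos.le
    change I.lam * I.g u + 1 / 4 * ‖u - z‖ ^ 2 ≤ _ + (I.lam * I.M + 1 / 2) / 2 * _
    nlinarith

theorem Regular.acg_obj (hI : I.Regular) (z : Vec n) {w : Vec n} (hw : w ∈ effDom I.h) :
    (I.acg z).obj w = I.lam * I.val w + 1 / 2 * ‖w - z‖ ^ 2 := by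
  unfold ACGInput.obj val
  have : ((I.acg z).ψn w).toReal = I.lam * (I.h w).toReal + 1 / 4 * ‖w - z‖ ^ 2 :=
    hI.conv.toReal_coe_mul_add_coe I.lam hw _
  rw [this]
  change I.lam * I.g w + 1 / 4 * ‖w - z‖ ^ 2 + _ = _
  ring

theorem Regular.isProxApprox_iff (hI : I.Regular) {z x u : Vec n} {η : ℝ} :
    I.IsProxApprox z x u η ↔ 0 ≤ η ∧ x ∈ effDom I.h ∧
      (∀ w ∈ effDom I.h, I.lam * I.val x + 1 / 2 * ‖x - z‖ ^ 2 + (⟪u, w - x⟫ - η)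
        ≤ I.lam * I.val w + 1 / 2 * ‖w - z‖ ^ 2) ∧
      ‖u‖ ^ 2 + 2 * η ≤ I.σ * ‖z - x + u‖ ^ 2 := by
  have hin : ∀ w ∈ effDom I.h, (I.lam : EReal) * ((I.g w : EReal) + I.h w)
      + ((1 / 2 * ‖w - z‖ ^ 2 : ℝ) : EReal)
      = ((I.lam * I.val w + 1 / 2 * ‖w - z‖ ^ 2 : ℝ) : EReal) := by
    intro w hw
    rw [← hI.conv.coe_toReal hw]
    unfold val
    norm_cast
  have hout : ∀ w ∉ effDom I.h, (I.lam : EReal) * ((I.g w : EReal) + I.h w)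
      + ((1 / 2 * ‖w - z‖ ^ 2 : ℝ) : EReal) = ⊤ := by
    intro w hw
    rw [eq_top_of_notMem_effDom hw, EReal.coe_add_top, EReal.coe_mul_top_of_pos hI.lam_pos,
      EReal.top_add_coe]
  unfold IsProxApprox epsSubdiff
  refine and_congr_right fun _ => ?_
  rw [← and_assoc]
  refine and_congr_left fun _ => ?_
  constructor
  · rintro ⟨h1, h2⟩
    have hx : x ∈ effDom I.h := by
      by_contra hx
      have h1' : (I.lam : EReal) * ((I.g x : EReal) + I.h x)
        + ((1 / 2 * ‖x - z‖ ^ 2 : ℝ) : EReal) < ⊤ := h1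
      rw [hout x hx] at h1'
      exact lt_irrefl _ h1'
    refine ⟨hx, fun w hw => ?_⟩
    have := h2 w
    beta_reduce at this
    rw [hin x hx, hin w hw] at this
    exact_mod_cast this
  · rintro ⟨hx, h2⟩
    refine ⟨?_, fun w => ?_⟩
    · change (I.lam : EReal) * ((I.g x : EReal) + I.h x)
        + ((1 / 2 * ‖x - z‖ ^ 2 : ℝ) : EReal) < ⊤
      rw [hin x hx]
      exact EReal.coe_lt_top _
    · beta_reduce
      by_cases hw : w ∈ effDom I.h
      · rw [hin x hx, hin w hw]
        exact_mod_cast h2 w hw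
      · rw [hout w hw]
        exact le_top

/-! ### The ACG iterates of a prox subproblem -/

section ACG

variable {z : Vec n} {j : ℕ}

theorem Regular.acg_x_mem (hI : I.Regular) (hz : z ∈ effDom I.h) (j : ℕ) :
    (I.acg z).x j ∈ effDom I.h := by
  rw [← hI.effDom_acg z]
  exact ((hI.acg_admissible hz).invariant j).x_mem

theorem Regular.acg_obj_ge (hI : I.Regular) (hz : z ∈ effDom I.h) (hj : 1 ≤ j) {w : Vec n}
    (hw : w ∈ effDom I.h) :
    I.lam * I.val ((I.acg z).x j) + 1 / 2 * ‖(I.acg z).x j - z‖ ^ 2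
        + (⟪(I.acg z).u j, w - (I.acg z).x j⟫ - (I.acg z).η j)
        + 1 / 4 * ‖w - ((I.acg z).iter j).y‖ ^ 2
      ≤ I.lam * I.val w + 1 / 2 * ‖w - z‖ ^ 2 := by
  have h := (hI.acg_admissible hz).obj_ge hj (w := w) (by rw [hI.effDom_acg]; exact hw)
  rw [hI.acg_obj z hw, hI.acg_obj z (hI.acg_x_mem hz j)] at h
  change _ + (1 / 2 : ℝ) / 2 * _ ≤ _ at h
  linarith

/-- The certificate `acg_obj_ge` tested at `x_j` itself: only the strong convexity surplus survives.
-/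
theorem Regular.acg_dist_sq_le_η (hI : I.Regular) (hz : z ∈ effDom I.h) (hj : 1 ≤ j) :
    1 / 4 * ‖(I.acg z).x j - ((I.acg z).iter j).y‖ ^ 2 ≤ (I.acg z).η j := by
  have h := hI.acg_obj_ge hz hj (hI.acg_x_mem hz j)
  rw [sub_self, inner_zero_right] at h
  linarith

theorem Regular.acg_η_nonneg (hI : I.Regular) (hz : z ∈ effDom I.h) (hj : 1 ≤ j) :
    0 ≤ (I.acg z).η j :=
  le_trans (by positivity) (hI.acg_dist_sq_le_η hz hj)

theorem Regular.acg_residual_le (hI : I.Regular) (hz : z ∈ effDom I.h) (hj : 1 ≤ j) :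
    ‖(I.acg z).x j - ((I.acg z).iter j).y‖ ^ 2 + 2 * ((I.acg z).iter j).A * (I.acg z).η j
      ≤ ‖(I.acg z).x j - z‖ ^ 2 :=
  (hI.acg_admissible hz).residual_le hj

/-- Inserting `‖x - y‖² / 4 ≤ η` into `acg_residual_le` gives `(1 + A / 2) ‖x - y‖² ≤ ‖x - z‖²`, and
`A ≥ 18` makes the factor at least `10`. -/
theorem Regular.acg_dist_le (hI : I.Regular) (hz : z ∈ effDom I.h) (hj : 1 ≤ j)
    (hA : 18 ≤ ((I.acg z).iter j).A) :
    ‖(I.acg z).x j - ((I.acg z).iter j).y‖ ≤ 1 / 3 * ‖(I.acg z).x j - z‖ := by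
  have h1 := hI.acg_dist_sq_le_η hz hj
  have h2 := hI.acg_residual_le hz hj
  refine le_of_sq_le_sq ?_ (by positivity)
  have h3 : 18 * (1 / 4 * ‖(I.acg z).x j - ((I.acg z).iter j).y‖ ^ 2)
      ≤ ((I.acg z).iter j).A * (I.acg z).η j := by gcongr
  nlinarith

theorem Regular.acg_u_norm_le (hI : I.Regular) (hz : z ∈ effDom I.h) (hj : 1 ≤ j)
    (hA : 18 ≤ ((I.acg z).iter j).A) :
    ((I.acg z).iter j).A * ‖(I.acg z).u j‖ ≤ 4 / 3 * ‖(I.acg z).x j - z‖ := by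
  have h1 := hI.acg_dist_le hz hj hA
  have hA0 : 0 < ((I.acg z).iter j).A := by linarith
  have h2 : ((I.acg z).iter j).A * ‖(I.acg z).u j‖ = ‖z - ((I.acg z).iter j).y‖ := by
    unfold ACGInput.u
    rw [norm_smul, Real.norm_eq_abs, abs_of_pos (by positivity), ← mul_assoc,
      mul_one_div_cancel hA0.ne', one_mul]
    rfl
  rw [h2]
  have h3 := norm_sub_le_norm_sub_add_norm_sub z ((I.acg z).x j) ((I.acg z).iter j).y
  rw [norm_sub_rev z ((I.acg z).x j)] at h3
  linarith

theorem Regular.acg_u_norm_le' (hI : I.Regular) (hz : z ∈ effDom I.h) (hj : 1 ≤ j)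
    (hA : 18 ≤ ((I.acg z).iter j).A) :
    ‖(I.acg z).u j‖ ≤ 2 / 27 * ‖(I.acg z).x j - z‖ := by
  have h1 := hI.acg_u_norm_le hz hj hA
  have h2 : 18 * ‖(I.acg z).u j‖ ≤ ((I.acg z).iter j).A * ‖(I.acg z).u j‖ := by gcongr
  linarith

theorem Regular.acg_dist_le_residual (hI : I.Regular) (hz : z ∈ effDom I.h) (hj : 1 ≤ j)
    (hA : 18 ≤ ((I.acg z).iter j).A) :
    25 / 27 * ‖(I.acg z).x j - z‖ ≤ ‖z - (I.acg z).x j + (I.acg z).u j‖ := by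
  have h1 := hI.acg_u_norm_le' hz hj hA
  have h2 := norm_sub_le (z - (I.acg z).x j + (I.acg z).u j) ((I.acg z).u j)
  rw [add_sub_cancel_right, norm_sub_rev z ((I.acg z).x j)] at h2
  linarith

/-- Late ACG iterates are `σ`-approximate solutions of the prox subproblem. -/
theorem Regular.isProxApprox_acg (hI : I.Regular) (hz : z ∈ effDom I.h) (hj : 1 ≤ j)
    (hA : 18 ≤ I.σ * ((I.acg z).iter j).A) :
    I.IsProxApprox z ((I.acg z).x j) ((I.acg z).u j) ((I.acg z).η j) := by
  have hσ := hI.σ_pos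
  have hσ1 := hI.σ_lt_one
  have hA18 : 18 ≤ ((I.acg z).iter j).A := by nlinarith
  refine hI.isProxApprox_iff.2 ⟨hI.acg_η_nonneg hz hj, hI.acg_x_mem hz j, fun w hw => ?_, ?_⟩
  · have := hI.acg_obj_ge hz hj hw
    have h0 : 0 ≤ 1 / 4 * ‖w - ((I.acg z).iter j).y‖ ^ 2 := by positivity
    linarith
  · have h1 := hI.acg_u_norm_le hz hj hA18
    have h2 := hI.acg_residual_le hz hj
    have h3 := pow_le_pow_left₀ (by positivity) (hI.acg_dist_le_residual hz hj hA18) 2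
    have hη := hI.acg_η_nonneg hz hj
    set A := ((I.acg z).iter j).A
    set r := ‖(I.acg z).x j - z‖
    set W := ‖z - (I.acg z).x j + (I.acg z).u j‖
    set a := ‖(I.acg z).u j‖
    set e := (I.acg z).η j
    -- Both `A ‖u‖²` and `2 A η` are at most constants times `r²`, while `σ A ≥ 18` makes the
    -- right-hand side of the test at least `18 (25 / 27)² r²` after multiplication by `A`.
    have h4 : A * a ^ 2 ≤ 16 / 162 * r ^ 2 := by
      have h5 : (A * a) ^ 2 ≤ (4 / 3 * r) ^ 2 := pow_le_pow_left₀ (by positivity) h1 2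
      have h6 : 18 * (A * a ^ 2) ≤ A * (A * a ^ 2) := by gcongr
      nlinarith
    have h5 : 2 * A * e ≤ r ^ 2 := by
      nlinarith [sq_nonneg ‖(I.acg z).x j - ((I.acg z).iter j).y‖]
    have h6 : A * (a ^ 2 + 2 * e) ≤ A * (I.σ * W ^ 2) := by
      have h7 : 18 * W ^ 2 ≤ I.σ * A * W ^ 2 := by gcongr
      nlinarith
    exact le_of_mul_le_mul_left h6 (by linarith)

/-- Both iterates nearly minimize the same strongly convex function, with errors `r² / 36` and `r'²
/ 36` because `A ≥ 18`. Adding the two comparisons gives `‖x_i - y_j‖ ≤ (r + r') / 3`, and the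
triangle inequality through `y_j` and `x_j` yields `r' ≤ (r + r') / 3 + r / 3 + r`. It controls the
iterates produced when a run is continued past the first test. -/
theorem Regular.acg_dist_le_dist (hI : I.Regular) (hz : z ∈ effDom I.h) {i : ℕ} (hj : 1 ≤ j)
    (hA : 18 ≤ ((I.acg z).iter j).A) (hA' : 18 ≤ ((I.acg z).iter i).A) :
    ‖(I.acg z).x i - z‖ ≤ 5 / 2 * ‖(I.acg z).x j - z‖ := by
  have hd := hI.effDom_acg z
  have hx := hI.acg_x_mem hz j
  have hx' := hI.acg_x_mem hz i
  have h1 := (hI.acg_admissible hz).obj_le j (w := (I.acg z).x i) (by rw [hd]; exact hx')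
  have h2 := (hI.acg_admissible hz).obj_le i (w := (I.acg z).x j) (by rw [hd]; exact hx)
  have h3 := hI.acg_dist_le hz hj hA
  change _ + (1 + 1 / 2 * _) / 2 * _ ≤ _ + 1 / 2 * ‖(I.acg z).x i - z‖ ^ 2 at h1
  change _ + (1 + 1 / 2 * _) / 2 * _ ≤ _ + 1 / 2 * ‖(I.acg z).x j - z‖ ^ 2 at h2
  have h4 := norm_sub_le_norm_sub_add_norm_sub ((I.acg z).x i) ((I.acg z).iter j).y z
  have h5 := norm_sub_le_norm_sub_add_norm_sub ((I.acg z).iter j).y ((I.acg z).x j) z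
  rw [norm_sub_rev ((I.acg z).iter j).y ((I.acg z).x j)] at h5
  set A := ((I.acg z).iter j).A
  set A' := ((I.acg z).iter i).A
  set r := ‖(I.acg z).x j - z‖
  set r' := ‖(I.acg z).x i - z‖
  set F := (I.acg z).obj ((I.acg z).x j)
  set F' := (I.acg z).obj ((I.acg z).x i)
  have hr : 0 ≤ r := norm_nonneg _
  have hr' : 0 ≤ r' := norm_nonneg _
  have h6 : F + 1 / 4 * ‖(I.acg z).x i - ((I.acg z).iter j).y‖ ^ 2 ≤ F' + 1 / 36 * r' ^ 2 := by
    have : A * (F + 1 / 4 * ‖(I.acg z).x i - ((I.acg z).iter j).y‖ ^ 2)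
        ≤ A * (F' + 1 / 36 * r' ^ 2) := by
      have : 18 * r' ^ 2 ≤ A * r' ^ 2 := by gcongr
      nlinarith [sq_nonneg ‖(I.acg z).x i - ((I.acg z).iter j).y‖]
    exact le_of_mul_le_mul_left this (by linarith)
  have h7 : F' ≤ F + 1 / 36 * r ^ 2 := by
    have : A' * F' ≤ A' * (F + 1 / 36 * r ^ 2) := by
      have h8 : 18 * r ^ 2 ≤ A' * r ^ 2 := by gcongr
      have h9 : 0 ≤ (1 + 1 / 2 * A') / 2 * ‖(I.acg z).x j - ((I.acg z).iter i).y‖ ^ 2 := by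
        positivity
      nlinarith
    exact le_of_mul_le_mul_left this (by linarith)
  have h8 : ‖(I.acg z).x i - ((I.acg z).iter j).y‖ ≤ (r + r') / 3 := by
    refine le_of_sq_le_sq ?_ (by positivity)
    nlinarith [mul_nonneg hr hr']
  linarith

end ACG

/-! ### Numbers of ACG iterations that suffice for each test -/

variable {z : Vec n}

/-- A number of ACG iterations after which every iterate is a `σ`-approximate solution. -/
noncomputable def approxIters (I : AIPPInput n) : ℕ := ⌈9 * √(I.curv / I.σ)⌉₊

/-- A number of ACG iterations after which every iterate meets the tolerance on `η`. -/
noncomputable def accurateIters (I : AIPPInput n) : ℕ :=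
  max I.approxIters (⌈4 * √I.curv * Real.log (2 * I.curv)⌉₊ + 1)

theorem Regular.one_le_of_ceil_le (hI : I.Regular) {j : ℕ}
    (hj : ⌈6 * √(2 * I.lam * I.M + 1)⌉₊ ≤ j) : 1 ≤ j := by
  refine le_trans ?_ hj
  rw [Nat.one_le_ceil_iff]
  have : 0 < 2 * I.lam * I.M + 1 := by linarith [hI.half_le]
  positivity

/-- The prescribed minimal number of iterations is chosen for this: `j² ≥ 36 · 2 L` and `A_j ≥ j² /
(4 L)` give `18`. -/
theorem Regular.A_ge_of_ceil_le (hI : I.Regular) (hz : z ∈ effDom I.h) {j : ℕ}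
    (hj : ⌈6 * √(2 * I.lam * I.M + 1)⌉₊ ≤ j) : 18 ≤ ((I.acg z).iter j).A := by
  have h1 := (hI.acg_admissible hz).A_ge_sq j
  have hL : (I.acg z).L = I.curv := rfl
  rw [hL] at h1
  have hc := hI.one_le_curv
  refine le_trans ?_ h1
  have h2 : (6 * √(2 * I.lam * I.M + 1)) ≤ j := Nat.ceil_le.1 hj
  have h3 := pow_le_pow_left₀ (by positivity) h2 2
  have e : 2 * I.lam * I.M + 1 = 2 * I.curv := by unfold curv; ring
  rw [e, mul_pow, Real.sq_sqrt (by positivity)] at h3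
  rw [le_div_iff₀ (by positivity)]
  linarith

theorem Regular.ceil_le_approxIters (hI : I.Regular) :
    ⌈6 * √(2 * I.lam * I.M + 1)⌉₊ ≤ I.approxIters := by
  have hc := hI.one_le_curv
  have hσ := hI.σ_pos
  refine Nat.ceil_le_ceil ?_
  have e : 2 * I.lam * I.M + 1 = 2 * I.curv := by unfold curv; ring
  refine le_of_sq_le_sq ?_ (by positivity)
  rw [e, mul_pow, mul_pow, Real.sq_sqrt (by positivity), Real.sq_sqrt (by positivity)]
  have : I.curv ≤ I.curv / I.σ := by
    rw [le_div_iff₀ hσ]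
    nlinarith [hI.σ_lt_one]
  linarith

theorem Regular.A_ge_of_approxIters_le (hI : I.Regular) (hz : z ∈ effDom I.h) {j : ℕ}
    (hj : I.approxIters ≤ j) : 18 ≤ I.σ * ((I.acg z).iter j).A := by
  have h1 := (hI.acg_admissible hz).A_ge_sq j
  have hL : (I.acg z).L = I.curv := rfl
  rw [hL] at h1
  have hc := hI.one_le_curv
  have hσ := hI.σ_pos
  have h2 : 9 * √(I.curv / I.σ) ≤ j := Nat.ceil_le.1 hj
  have h3 := pow_le_pow_left₀ (by positivity) h2 2
  rw [mul_pow, Real.sq_sqrt (by positivity)] at h3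
  have h4 : 18 ≤ I.σ * ((j : ℝ) ^ 2 / (4 * I.curv)) := by
    have : I.σ * ((9 : ℝ) ^ 2 * (I.curv / I.σ) / (4 * I.curv)) = 81 / 4 := by
      field_simp; norm_num
    have h5 : I.σ * ((9 : ℝ) ^ 2 * (I.curv / I.σ) / (4 * I.curv))
      ≤ I.σ * ((j : ℝ) ^ 2 / (4 * I.curv)) := by gcongr
    linarith
  exact h4.trans (by gcongr)

theorem Regular.A_ge_of_accurateIters_le (hI : I.Regular) (hz : z ∈ effDom I.h) {j : ℕ}
    (hj : I.accurateIters ≤ j) : I.curv ≤ ((I.acg z).iter j).A := by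
  have hadm := hI.acg_admissible hz
  have hc := hI.one_le_curv
  have hk : ⌈4 * √I.curv * Real.log (2 * I.curv)⌉₊ + 1 ≤ j := (le_max_right _ _).trans hj
  obtain ⟨k, rfl⟩ : ∃ k, j = k + 1 := ⟨j - 1, by omega⟩
  have hk' : 4 * √I.curv * Real.log (2 * I.curv) ≤ k := Nat.ceil_le.1 (by omega)
  have h1 := hadm.sqrt_A_ge_pow k
  have hL : (I.acg z).L = I.curv := rfl
  have hμ : (I.acg z).μ = 1 / 2 := rfl
  rw [hL, hμ] at h1
  have hs0 : 1 ≤ √I.curv := Real.one_le_sqrt.2 hc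
  have hs2 : √I.curv ^ 2 = I.curv := Real.sq_sqrt (by positivity)
  set s := √I.curv
  set t := 1 / 2 * √(1 / 2 / I.curv)
  -- Here `t = 1 / (2 √2 s)`, so `log (1 + t) ≥ 1 / (3 s + 1) ≥ 1 / (4 s)` as `s ≥ 1`. This explains
  -- the factor `4 √L` in `accurateIters`; reaching `(1 + t)^k ≥ 2 L` then means `√A ≥ 2 L / (2 s) =
  -- s`.
  have ht : 1 / (3 * s) ≤ t := by
    refine le_of_sq_le_sq ?_ (by positivity)
    rw [mul_pow, Real.sq_sqrt (by positivity), div_pow, mul_pow, hs2]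
    rw [div_pow, div_div, div_mul_div_comm, div_le_div_iff₀ (by positivity) (by positivity)]
    nlinarith
  have hlog : 1 / (4 * s) ≤ Real.log (1 + t) := by
    have h2 := Real.one_sub_inv_le_log_of_pos (by positivity : 0 < 1 + 1 / (3 * s))
    have h3 : Real.log (1 + 1 / (3 * s)) ≤ Real.log (1 + t) := by
      apply Real.log_le_log (by positivity); linarith
    refine le_trans ?_ (h2.trans h3)
    have e : 1 - (1 + 1 / (3 * s))⁻¹ = 1 / (3 * s + 1) := by field_simp; ring
    rw [e]
    apply one_div_le_one_div_of_le (by positivity)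
    linarith
  have hpow : 2 * I.curv ≤ (1 + t) ^ k := by
    rw [← Real.log_le_log_iff (by positivity) (by positivity), Real.log_pow]
    have hlog0 : 0 ≤ Real.log (2 * I.curv) := Real.log_nonneg (by linarith)
    calc Real.log (2 * I.curv) = (4 * s * Real.log (2 * I.curv)) * (1 / (4 * s)) := by field_simp
      _ ≤ k * Real.log (1 + t) := mul_le_mul hk' hlog (by positivity) (by positivity)
  have h2 : s ≤ √((I.acg z).iter (k + 1)).A := by
    refine le_trans ?_ h1
    rw [le_div_iff₀ (by positivity)]
    nlinarith
  have h3 := pow_le_pow_left₀ (by positivity) h2 2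
  rwa [hs2, Real.sq_sqrt (hadm.A_nonneg _)] at h3

/-! ### The two stopping tests -/

theorem Regular.isStepOne_le (hI : I.Regular) (hz : z ∈ effDom I.h) {j : ℕ}
    (hj : I.IsStepOne z j) : j ≤ I.approxIters :=
  hj.2 ⟨hI.ceil_le_approxIters, hI.isProxApprox_acg hz
    (hI.one_le_of_ceil_le hI.ceil_le_approxIters) (hI.A_ge_of_approxIters_le hz le_rfl)⟩

theorem Regular.exists_isStepOne (hI : I.Regular) (hz : z ∈ effDom I.h) :
    ∃ j, I.IsStepOne z j :=
  exists_isLeast_of_nonempty ⟨I.approxIters, hI.ceil_le_approxIters, hI.isProxApprox_acg hz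
    (hI.one_le_of_ceil_le hI.ceil_le_approxIters) (hI.A_ge_of_approxIters_le hz le_rfl)⟩

theorem Regular.acg_dist_le_of_isStepOne (hI : I.Regular) (hz : z ∈ effDom I.h) {j i : ℕ}
    (hj : I.IsStepOne z j)
    (hr : ‖z - (I.acg z).x j + (I.acg z).u j‖ ≤ I.lam * I.ρ / 5) (hi : j ≤ i) :
    ‖(I.acg z).x i - z‖ ≤ 27 / 10 * (I.lam * I.ρ / 5) := by
  have hj1 := hI.one_le_of_ceil_le hj.1.1
  have hA := hI.A_ge_of_ceil_le hz hj.1.1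
  have hA' : 18 ≤ ((I.acg z).iter i).A := hA.trans ((hI.acg_admissible hz).A_mono hi)
  have h1 := hI.acg_dist_le_dist hz hj1 hA hA'
  have h2 := hI.acg_dist_le_residual hz hj1 hA
  linarith

/-- Continuing the run may lengthen the residual, but only boundedly: `(1 + 2 / 27) · 27 / 10 = 29 /
10 ≤ 3`. -/
theorem Regular.acg_residual_le_of_isStepOne (hI : I.Regular) (hz : z ∈ effDom I.h) {j i : ℕ}
    (hj : I.IsStepOne z j)
    (hr : ‖z - (I.acg z).x j + (I.acg z).u j‖ ≤ I.lam * I.ρ / 5) (hi : j ≤ i) :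
    ‖z - (I.acg z).x i + (I.acg z).u i‖ ≤ 3 * (I.lam * I.ρ / 5) := by
  have hj1 := hI.one_le_of_ceil_le hj.1.1
  have hA := hI.A_ge_of_ceil_le hz hj.1.1
  have hA' : 18 ≤ ((I.acg z).iter i).A := hA.trans ((hI.acg_admissible hz).A_mono hi)
  have h1 := hI.acg_dist_le_of_isStepOne hz hj hr hi
  have h2 := hI.acg_u_norm_le' hz (hj1.trans hi) hA'
  have h3 := norm_add_le (z - (I.acg z).x i) ((I.acg z).u i)
  rw [norm_sub_rev z ((I.acg z).x i)] at h3
  linarith [(norm_nonneg _).trans hr]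

theorem Regular.accurateIters_mem (hI : I.Regular) (hz : z ∈ effDom I.h) {j : ℕ}
    (hj : I.IsStepOne z j)
    (hr : ‖z - (I.acg z).x j + (I.acg z).u j‖ ≤ I.lam * I.ρ / 5) :
    j ≤ I.accurateIters ∧
      I.IsProxApprox z ((I.acg z).x I.accurateIters) ((I.acg z).u I.accurateIters)
        ((I.acg z).η I.accurateIters) ∧
      (I.acg z).η I.accurateIters / I.lam ≤ I.ε := by
  have hji : j ≤ I.accurateIters := (hI.isStepOne_le hz hj).trans (le_max_left _ _)
  have h1 := (hI.one_le_of_ceil_le hj.1.1).trans hji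
  refine ⟨hji, hI.isProxApprox_acg hz h1 (hI.A_ge_of_approxIters_le hz (le_max_left _ _)), ?_⟩
  have h2 := hI.acg_dist_le_of_isStepOne hz hj hr hji
  have h3 := hI.acg_residual_le hz h1
  have h4 := hI.A_ge_of_accurateIters_le hz le_rfl
  have hη := hI.acg_η_nonneg hz h1
  have hc := hI.one_le_curv
  have hl := hI.lam_pos
  rw [div_le_iff₀ hl]
  have h5 := pow_le_pow_left₀ (norm_nonneg _) h2 2
  have h6 : I.curv * (I.acg z).η I.accurateIters
      ≤ ((I.acg z).iter I.accurateIters).A * (I.acg z).η I.accurateIters := by gcongr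
  -- With `A ≥ L`, `2 L η ≤ (27 / 10)² (λ ρ / 5)²`, that is `L η ≤ (7.29 / 50) (λ ρ)²`; the field
  -- `tol` allows `9 / 50`.
  have h7 := mul_le_mul_of_nonneg_left hI.tol hl.le
  have h8 : I.curv * (I.acg z).η I.accurateIters ≤ I.curv * (I.ε * I.lam) := by
    change _ ≤ I.lam * (50 * I.curv * I.ε) at h7
    nlinarith [sq_nonneg ‖(I.acg z).x I.accurateIters - ((I.acg z).iter I.accurateIters).y‖,
      sq_nonneg (I.lam * I.ρ)]
  exact le_of_mul_le_mul_left h8 (by linarith)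

theorem Regular.isStepThree_le (hI : I.Regular) (hz : z ∈ effDom I.h) {j j' : ℕ}
    (hj : I.IsStepOne z j)
    (hr : ‖z - (I.acg z).x j + (I.acg z).u j‖ ≤ I.lam * I.ρ / 5)
    (hj' : I.IsStepThree z j j') : j' ≤ I.accurateIters :=
  hj'.2 (hI.accurateIters_mem hz hj hr)

theorem Regular.exists_isStepThree (hI : I.Regular) (hz : z ∈ effDom I.h) {j : ℕ}
    (hj : I.IsStepOne z j)
    (hr : ‖z - (I.acg z).x j + (I.acg z).u j‖ ≤ I.lam * I.ρ / 5) :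
    ∃ j', I.IsStepThree z j j' :=
  exists_isLeast_of_nonempty ⟨I.accurateIters, hI.accurateIters_mem hz hj hr⟩

/-! ### Descent properties of approximate prox steps -/

/-- The `η`-subgradient inequality at the prox center contains exactly half of `‖z - x + u‖²` minus
half of `‖u‖² + 2 η`, and the relative error test bounds the latter by a fraction `σ` of the former.
-/
theorem Regular.val_descent (hI : I.Regular) (hz : z ∈ effDom I.h) {x u : Vec n} {η : ℝ}
    (h : I.IsProxApprox z x u η) :
    I.lam * I.val x + (1 - I.σ) / 2 * ‖z - x + u‖ ^ 2 ≤ I.lam * I.val z := by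
  obtain ⟨_, _, h3, h4⟩ := hI.isProxApprox_iff.1 h
  have h5 := h3 z hz
  rw [sub_self, norm_zero] at h5
  have h6 := norm_add_sq_real (z - x) u
  rw [real_inner_comm, norm_sub_rev z x] at h6
  linarith

/-- The value after one step is compared with an arbitrary `w`, independently of the value at the
center `z`. This is what makes the complexity insensitive to infeasibility of the starting point. -/
theorem Regular.val_gap_le (hI : I.Regular) {x u w : Vec n} {η : ℝ} (hw : w ∈ effDom I.h)
    (h : I.IsProxApprox z x u η) :
    (1 - I.σ) * (I.lam * I.val x)
      ≤ (1 - I.σ) * (I.lam * I.val w) + 1 / 2 * ‖z - w‖ ^ 2 := by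
  obtain ⟨_, _, h3, h4⟩ := hI.isProxApprox_iff.1 h
  have h5 := h3 w hw
  have h6 := norm_add_sq_real (z - x) u
  rw [real_inner_comm, norm_sub_rev z x] at h6
  have h7 : ⟪u, w - x⟫ = ⟪u, z - x⟫ - ⟪u, z - w⟫ := by
    rw [← inner_sub_right]; congr 1; abel
  have h8 := real_inner_le_norm u (z - w)
  rw [norm_sub_rev w z, h7] at h5
  have hσ := hI.σ_pos
  have hσ1 := hI.σ_lt_one
  set a := ‖u‖
  set d := ‖z - w‖
  set W := ‖z - x + u‖
  have h9 : I.lam * I.val x ≤ I.lam * I.val w + 1 / 2 * d ^ 2 + a * d - (1 - I.σ) / 2 * W ^ 2 := by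
    linarith
  have h10 : a ^ 2 ≤ I.σ * W ^ 2 := by linarith [h.1]
  -- Young's inequality, weighted so that the `W²` term cancels the negative one in `h9` after
  -- multiplication by `1 - σ`, and the `d²` coefficients add up to `1/2`.
  have h11 : (1 - I.σ) * (a * d) ≤ (1 - I.σ) ^ 2 / 2 * W ^ 2 + I.σ / 2 * d ^ 2 := by
    refine le_of_mul_le_mul_left ?_ hσ
    nlinarith [sq_nonneg ((1 - I.σ) * a - I.σ * d),
      mul_le_mul_of_nonneg_left h10 (sq_nonneg (1 - I.σ))]
  have h12 := mul_le_mul_of_nonneg_left h9 (by linarith : 0 ≤ 1 - I.σ)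
  nlinarith

/-- The guaranteed decrease of `λ (g + h)` in an outer iteration which is not the last. -/
noncomputable def decrease (I : AIPPInput n) : ℝ := (1 - I.σ) / 2 * (I.lam * I.ρ / 5) ^ 2

theorem Regular.decrease_pos (hI : I.Regular) : 0 < I.decrease := by
  have h1 := hI.σ_lt_one
  have h2 := hI.lam_pos
  have h3 := hI.ρ_pos
  have h4 : 0 < 1 - I.σ := by linarith
  unfold decrease
  positivity

theorem Regular.val_add_decrease_le (hI : I.Regular) (hz : z ∈ effDom I.h) {j : ℕ}
    (hj : I.IsStepOne z j) (hr : I.lam * I.ρ / 5 < ‖z - (I.acg z).x j + (I.acg z).u j‖) :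
    I.lam * I.val ((I.acg z).x j) + I.decrease ≤ I.lam * I.val z := by
  have h1 := hI.val_descent hz hj.1.2
  have hl := hI.lam_pos
  have hρ := hI.ρ_pos
  have h2 := pow_le_pow_left₀ (by positivity) hr.le 2
  have h3 := mul_le_mul_of_nonneg_left h2
    (by linarith [hI.σ_lt_one] : 0 ≤ (1 - I.σ) / 2)
  unfold decrease
  linarith

/-! ### Runs of the AIPP method -/

theorem Regular.exists_run (hI : I.Regular) {m : ℝ} (hm : ∀ w ∈ effDom I.h, m ≤ I.val w)
    (hz : z ∈ effDom I.h) : ∃ out N, I.Run z out N := by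
  -- The gap, measured in units of the guaranteed decrease, bounds the number of nonfinal outer
  -- iterations; with `k = 0` no further decrease is possible.
  obtain ⟨k, hk⟩ := exists_nat_ge (I.lam * (I.val z - m) / I.decrease)
  rw [div_le_iff₀ hI.decrease_pos] at hk
  induction k generalizing z with
  | zero =>
    obtain ⟨j, hj⟩ := hI.exists_isStepOne hz
    rcases le_or_gt ‖z - (I.acg z).x j + (I.acg z).u j‖ (I.lam * I.ρ / 5) with hr | hr
    · obtain ⟨j', hj'⟩ := hI.exists_isStepThree hz hj hr
      exact ⟨_, _, Run.last z j j' hj hr hj'⟩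
    · have h1 := hI.val_add_decrease_le hz hj hr
      have h2 := mul_le_mul_of_nonneg_left (hm _ (hI.acg_x_mem hz j)) hI.lam_pos.le
      have h3 := hI.decrease_pos
      push_cast at hk
      linarith
  | succ k ih =>
    obtain ⟨j, hj⟩ := hI.exists_isStepOne hz
    rcases le_or_gt ‖z - (I.acg z).x j + (I.acg z).u j‖ (I.lam * I.ρ / 5) with hr | hr
    · obtain ⟨j', hj'⟩ := hI.exists_isStepThree hz hj hr
      exact ⟨_, _, Run.last z j j' hj hr hj'⟩
    · have h1 := hI.val_add_decrease_le hz hj hr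
      push_cast at hk
      obtain ⟨out, N, h⟩ := ih (hI.acg_x_mem hz j) (by linarith)
      exact ⟨out, j + N, Run.next z j out N hj hr h⟩

/-- The scaled gap serves as a potential: a nonfinal outer iteration costs at most `approxIters` and
uses up one unit of `decrease`; the final one costs at most `accurateIters`. -/
theorem Regular.run_le (hI : I.Regular) {m : ℝ} (hm : ∀ w ∈ effDom I.h, m ≤ I.val w)
    {out : AIPPOutput n} {N : ℕ} (h : I.Run z out N) (hz : z ∈ effDom I.h) :
    N * I.decrease ≤ I.approxIters * (I.lam * (I.val z - m)) + I.accurateIters * I.decrease := by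
  have hδ := hI.decrease_pos
  induction h with
  | last z j j' hj hr hj' =>
    have h1 : (j' : ℝ) ≤ I.accurateIters := by exact_mod_cast hI.isStepThree_le hz hj hr hj'
    have h2 := mul_le_mul_of_nonneg_right h1 hδ.le
    have h3 := mul_nonneg hI.lam_pos.le (sub_nonneg.2 (hm z hz))
    have h4 := mul_nonneg (Nat.cast_nonneg (α := ℝ) I.approxIters) h3
    linarith
  | next z j out N hj hr h ih =>
    have h1 : (j : ℝ) ≤ I.approxIters := by exact_mod_cast hI.isStepOne_le hz hj
    have h2 := mul_le_mul_of_nonneg_right h1 hδ.le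
    have h3 := mul_le_mul_of_nonneg_left (hI.val_add_decrease_le hz hj hr)
      (Nat.cast_nonneg (α := ℝ) I.approxIters)
    have h4 := ih (hI.acg_x_mem hz j)
    push_cast
    linarith

theorem Regular.run_output (hI : I.Regular) {out : AIPPOutput n} {N : ℕ} (h : I.Run z out N)
    (hz : z ∈ effDom I.h) :
    I.lam * I.val out.z ≤ I.lam * I.val z ∧ ∃ (zp u : Vec n) (η : ℝ),
      I.IsProxApprox zp out.z u η ∧ ‖zp - out.z + u‖ ≤ 3 * (I.lam * I.ρ / 5) ∧
      η / I.lam ≤ I.ε := by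
  induction h with
  | last z j j' hj hr hj' =>
    have h1 := hI.val_descent hz hj'.1.2.1
    have h2 : 0 ≤ (1 - I.σ) / 2 * ‖z - (I.acg z).x j' + (I.acg z).u j'‖ ^ 2 :=
      mul_nonneg (by linarith [hI.σ_lt_one]) (sq_nonneg _)
    exact ⟨by dsimp only; linarith, z, _, _, hj'.1.2.1,
      hI.acg_residual_le_of_isStepOne hz hj hr hj'.1.1, hj'.1.2.2⟩
  | next z j out N hj hr h ih =>
    obtain ⟨h1, h2⟩ := ih (hI.acg_x_mem hz j)
    have h3 := hI.val_add_decrease_le hz hj hr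
    have h4 := hI.decrease_pos
    exact ⟨by linarith, h2⟩

/-- Complexity of the AIPP method in terms of a bound `B` on the objective gap after the first
outer iteration, which also bounds the objective gap at the output. -/
theorem Regular.run_le_of_gap (hI : I.Regular) {m B : ℝ} (hm : ∀ w ∈ effDom I.h, m ≤ I.val w)
    (hz : z ∈ effDom I.h)
    (hB : ∀ x u η, I.IsProxApprox z x u η → I.lam * (I.val x - m) ≤ B)
    {out : AIPPOutput n} {N : ℕ} (h : I.Run z out N) :
    I.lam * (I.val out.z - m) ≤ B ∧
      N * I.decrease ≤ I.approxIters * B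
        + (I.approxIters + I.accurateIters) * I.decrease := by
  have hδ := hI.decrease_pos
  cases h with
  | last _ j _ hj hr hj' =>
    have h0 := hB _ _ _ hj'.1.2.1
    refine ⟨h0, ?_⟩
    have h1 : (N : ℝ) ≤ I.accurateIters := by exact_mod_cast hI.isStepThree_le hz hj hr hj'
    have h2 := mul_le_mul_of_nonneg_right h1 hδ.le
    have h3 := (mul_nonneg hI.lam_pos.le (sub_nonneg.2 (hm _ (hI.acg_x_mem hz N)))).trans h0
    have h4 := mul_nonneg (Nat.cast_nonneg (α := ℝ) I.approxIters) h3
    have h5 := mul_nonneg (Nat.cast_nonneg (α := ℝ) I.approxIters) hδ.le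
    linarith
  -- The first outer iteration is charged separately, so that the potential argument starts from its
  -- result, whose gap is at most `B`.
  | next _ j _ N hj hr h =>
    have h0 := hB _ _ _ hj.1.2
    have hx := hI.acg_x_mem hz j
    have h1 : (j : ℝ) ≤ I.approxIters := by exact_mod_cast hI.isStepOne_le hz hj
    have h2 := mul_le_mul_of_nonneg_right h1 hδ.le
    have h3 := hI.run_le hm h hx
    have h4 := mul_le_mul_of_nonneg_left h0 (Nat.cast_nonneg (α := ℝ) I.approxIters)
    have h5 := (hI.run_output h hx).1
    refine ⟨by linarith, ?_⟩
    push_cast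
    linarith

theorem Regular.approxIters_le (hI : I.Regular) :
    (I.approxIters : ℝ) ≤ 10 * √(I.curv / I.σ) := by
  have hc := hI.one_le_curv
  have hσ := hI.σ_pos
  have h1 : 1 ≤ √(I.curv / I.σ) := by
    rw [Real.one_le_sqrt, one_le_div hσ]
    linarith [hI.σ_lt_one]
  have h2 := (Nat.ceil_lt_add_one (by positivity : 0 ≤ 9 * √(I.curv / I.σ))).le
  unfold approxIters
  linarith

theorem Regular.accurateIters_le (hI : I.Regular) :
    (I.accurateIters : ℝ) ≤ √(I.curv / I.σ) * (12 + 4 * Real.log (2 * I.curv)) := by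
  have hc := hI.one_le_curv
  have hσ := hI.σ_pos
  have h0 : √I.curv ≤ √(I.curv / I.σ) := by
    apply Real.sqrt_le_sqrt
    rw [le_div_iff₀ hσ]
    nlinarith [hI.σ_lt_one]
  have h1 : 1 ≤ √I.curv := Real.one_le_sqrt.2 hc
  have hl : 0 ≤ Real.log (2 * I.curv) := Real.log_nonneg (by linarith)
  have h2 := (Nat.ceil_lt_add_one
    (by positivity : 0 ≤ 4 * √I.curv * Real.log (2 * I.curv))).le
  have h3 := hI.approxIters_le
  have h4 := mul_le_mul_of_nonneg_right h0 hl
  have h5 := mul_nonneg (Real.sqrt_nonneg (I.curv / I.σ)) hl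
  unfold accurateIters
  rw [Nat.cast_max]
  refine max_le (by linarith) ?_
  push_cast
  linarith

end AIPPInput

variable {l : ℕ}

namespace AIPPInput

variable {I : AIPPInput n} {z : Vec n}

/-! ### The composite gradient step -/

theorem Regular.grad_const_pos (hI : I.Regular) : 0 < I.M + I.lam⁻¹ := by
  have h1 := hI.half_le
  have h2 := hI.lam_pos
  have h3 : 0 < I.M := by
    by_contra! h
    nlinarith
  positivity

theorem Regular.zg_spec (hI : I.Regular) (z : Vec n) :
    I.zg z ∈ effDom I.h ∧ ∀ u ∈ effDom I.h,
      (I.h (I.zg z)).toReal + affApprox I.g (I.zg z) z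
          + (I.M + I.lam⁻¹) / 2 * ‖I.zg z - z‖ ^ 2 + (I.M + I.lam⁻¹) / 2 * ‖u - I.zg z‖ ^ 2
        ≤ (I.h u).toReal + affApprox I.g u z + (I.M + I.lam⁻¹) / 2 * ‖u - z‖ ^ 2 := by
  have h := hI.conv.argmin_spec (μ := 0) (strongConvexOn_zero.2 hI.conv.convexOn)
    (gradient I.g z) z (I.g z - ⟪gradient I.g z, z⟫) hI.grad_const_pos
    (F := fun u => (affApprox I.g u z : EReal) + I.h u
      + (((I.M + I.lam⁻¹) / 2 * ‖u - z‖ ^ 2 : ℝ) : EReal)) (fun u => by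
        rw [affApprox_eq, add_comm _ (I.h u), add_assoc, ← EReal.coe_add])
  refine ⟨h.1, fun u hu => ?_⟩
  have h2 := h.2 u hu
  rw [← affApprox_eq, ← affApprox_eq, zero_add] at h2
  change (I.h (I.zg z)).toReal + (affApprox I.g (I.zg z) z
    + (I.M + I.lam⁻¹) / 2 * ‖I.zg z - z‖ ^ 2) + (I.M + I.lam⁻¹) / 2 * ‖u - I.zg z‖ ^ 2 ≤ _ at h2
  linarith

theorem Regular.val_zg_le (hI : I.Regular) (hz : z ∈ effDom I.h) :
    I.val (I.zg z) + (I.M / 2 + I.lam⁻¹) * ‖I.zg z - z‖ ^ 2 ≤ I.val z := by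
  obtain ⟨h1, h2⟩ := hI.zg_spec z
  have h3 := h2 z hz
  have h4 := hI.upper _ h1 z hz
  have h5 : affApprox I.g z z = I.g z := by simp [affApprox]
  rw [h5, sub_self, norm_zero, norm_sub_rev z] at h3
  unfold val
  linarith

/-- The growth at the minimizer has the same coefficient as the proximal quadratic, so the
three-point identity cancels all squares and leaves a linear inequality. -/
theorem Regular.subdiff_zg (hI : I.Regular) (z : Vec n) :
    (I.M + I.lam⁻¹) • (z - I.zg z) - gradient I.g z ∈ subdiff I.h (I.zg z) := by
  obtain ⟨h1, h2⟩ := hI.zg_spec z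
  refine ⟨h1, fun u => ?_⟩
  by_cases hu : u ∈ effDom I.h
  · have h3 := h2 u hu
    have h4 := norm_sq_three_points u z (I.zg z)
    rw [← hI.conv.coe_toReal hu, ← hI.conv.coe_toReal h1]
    norm_cast
    rw [inner_sub_left, inner_smul_left]
    have h5 : ⟪I.zg z - z, u - I.zg z⟫ = - ⟪z - I.zg z, u - I.zg z⟫ := by
      rw [← inner_neg_left, neg_sub]
    have h6 : affApprox I.g u z - affApprox I.g (I.zg z) z
        = ⟪gradient I.g z, u - I.zg z⟫ := by
      rw [affApprox_eq, affApprox_eq, inner_sub_right]; ring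
    rw [h5] at h4
    rw [h4] at h3
    simp only [conj_trivial]
    linarith
  · rw [eq_top_of_notMem_effDom hu]
    exact le_top

/-- The approximate optimality of `z` limits how much the gradient step can lower the objective,
while `val_zg_le` forces a decrease proportional to the squared step. With `K = M + λ⁻¹` this is a
quadratic inequality in `K d`, namely `(K d)² ≤ (6 / 5) ρ (K d) + ρ²`, which excludes `K d > 2 ρ`.
-/
theorem Regular.zg_dist_le (hI : I.Regular) {zp u : Vec n} {η : ℝ}
    (hp : I.IsProxApprox zp z u η) (hr : ‖zp - z + u‖ ≤ 3 * (I.lam * I.ρ / 5))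
    (hη : η / I.lam ≤ I.ε) (htol : 2 * (I.M + I.lam⁻¹) * I.ε ≤ I.ρ ^ 2) :
    (I.M + I.lam⁻¹) * ‖I.zg z - z‖ ≤ 2 * I.ρ := by
  obtain ⟨_, hz, h3, _⟩ := hI.isProxApprox_iff.1 hp
  have hl := hI.lam_pos
  have hK := hI.grad_const_pos
  have h4 := h3 _ (hI.zg_spec z).1
  have h5 := norm_sq_three_points (I.zg z) zp z
  have h6 := mul_le_mul_of_nonneg_left (hI.val_zg_le hz) hl.le
  have h7 : ⟪z - zp, I.zg z - z⟫ - ⟪u, I.zg z - z⟫ ≤ ‖zp - z + u‖ * ‖I.zg z - z‖ := by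
    rw [← inner_sub_left, ← norm_neg (zp - z + u)]
    have : z - zp - u = -(zp - z + u) := by abel
    rw [this]
    exact real_inner_le_norm _ _
  rw [div_le_iff₀ hl] at hη
  have hll : I.lam * I.lam⁻¹ = 1 := mul_inv_cancel₀ hl.ne'
  set d := ‖I.zg z - z‖
  set W := ‖zp - z + u‖
  set K := I.M + I.lam⁻¹ with hKdef
  have hd : 0 ≤ d := norm_nonneg _
  have h8 : I.lam * K / 2 * d ^ 2 ≤ W * d + η := by
    have e : I.lam * K = I.lam * I.M + 1 := by rw [hKdef, mul_add, hll]
    have e2 : I.lam * ((I.M / 2 + I.lam⁻¹) * d ^ 2) = (I.lam * I.M / 2 + 1) * d ^ 2 := by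
      linear_combination d ^ 2 * hll
    rw [e]
    rw [mul_add, e2] at h6
    linarith
  have h9 : W * d ≤ 3 * (I.lam * I.ρ / 5) * d := by gcongr
  have h10 : (K * d) ^ 2 ≤ 6 / 5 * I.ρ * (K * d) + I.ρ ^ 2 := by
    have h11 : I.lam * (K / 2 * d ^ 2) ≤ I.lam * (3 / 5 * I.ρ * d + I.ε) := by linarith
    have h12 := le_of_mul_le_mul_left h11 hl
    have h13 := mul_le_mul_of_nonneg_left h12 (by positivity : 0 ≤ 2 * K)
    linarith
  have hρ := hI.ρ_pos
  by_contra! hcon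
  nlinarith

theorem vg_norm_le (I : AIPPInput n) {G : ℝ}
    (hG : ‖gradient I.g (I.zg z) - gradient I.g z‖ ≤ G * ‖I.zg z - z‖)
    (hK : 0 ≤ I.M + I.lam⁻¹) :
    ‖I.vg z‖ ≤ (I.M + I.lam⁻¹) * ‖I.zg z - z‖ + G * ‖I.zg z - z‖ := by
  unfold vg
  rw [add_sub_assoc]
  refine (norm_add_le _ _).trans (add_le_add ?_ hG)
  rw [norm_smul, Real.norm_eq_abs, abs_of_nonneg hK, norm_sub_rev]

end AIPPInput

namespace Problem

variable {P : Problem n l}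

/-! ### The penalized problems -/

theorem hasGradientAt_g (P : Problem n l) {w : Vec n} (hw : DifferentiableAt ℝ P.f w) (c : ℝ) :
    HasGradientAt (P.g c)
      (gradient P.f w + ContinuousLinearMap.adjoint P.A (c • (P.A w - P.b))) w := by
  rw [hasGradientAt_iff_hasFDerivAt]
  have h1 := hw.hasGradientAt.hasFDerivAt
  have h2 := ((P.A.hasFDerivAt (x := w)).sub_const P.b).norm_sq.const_mul (c / 2)
  unfold Problem.g
  convert! h1.add h2 using 1
  ext v
  simp [ContinuousLinearMap.adjoint_inner_left]
  ring

theorem g_sub_affApprox (P : Problem n l) {w : Vec n} (hw : DifferentiableAt ℝ P.f w)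
    (c : ℝ) (u : Vec n) :
    P.g c u - affApprox (P.g c) u w
      = P.f u - affApprox P.f u w + c / 2 * ‖P.A (u - w)‖ ^ 2 := by
  have h3 := norm_sq_three_points (P.A u) P.b (P.A w)
  unfold affApprox
  rw [(P.hasGradientAt_g hw c).gradient, inner_add_left, ContinuousLinearMap.adjoint_inner_left,
    inner_smul_left, map_sub]
  unfold Problem.g
  simp only [conj_trivial]
  linear_combination (c / 2) * h3

theorem norm_map_sq_le (P : Problem n l) {c : ℝ} (hc : 0 ≤ c) (v : Vec n) :
    c / 2 * ‖P.A v‖ ^ 2 ≤ c * ‖P.A‖ ^ 2 / 2 * ‖v‖ ^ 2 := by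
  have h := pow_le_pow_left₀ (norm_nonneg _) (P.A.le_opNorm v) 2
  rw [mul_pow] at h
  have := mul_le_mul_of_nonneg_left h (by positivity : 0 ≤ c / 2)
  linarith

namespace Assumptions

theorem lam_pos (hP : P.Assumptions) : 0 < P.lam := by
  have := hP.mf_pos
  unfold Problem.lam
  positivity

theorem Lf_pos (hP : P.Assumptions) : 0 < P.Lf := hP.mf_pos.trans_le hP.mf_le_Lf

theorem normA_pos (hP : P.Assumptions) : 0 < ‖P.A‖ := norm_pos_iff.2 hP.A_ne_zero

theorem g_upper (hP : P.Assumptions) {c : ℝ} (hc : 0 ≤ c) {u z : Vec n}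
    (hu : u ∈ effDom P.h) (hz : z ∈ effDom P.h) :
    P.g c u ≤ affApprox (P.g c) u z + (P.Lf + c * ‖P.A‖ ^ 2) / 2 * ‖u - z‖ ^ 2 := by
  have h1 := P.g_sub_affApprox (hP.f_diff z hz) c u
  have h2 := le_affApprox_add_of_lipschitz hP.h_conv.convexOn.1 hP.f_diff hP.f_lip hu hz
  have h3 := P.norm_map_sq_le hc (u - z)
  linarith

theorem g_lower (hP : P.Assumptions) {c : ℝ} (hc : 0 ≤ c) {u z : Vec n}
    (hu : u ∈ effDom P.h) (hz : z ∈ effDom P.h) :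
    affApprox (P.g c) u z - P.mf / 2 * ‖u - z‖ ^ 2 ≤ P.g c u := by
  have h1 := P.g_sub_affApprox (hP.f_diff z hz) c u
  have h2 := hP.f_lower u hu z hz
  have h3 : 0 ≤ c / 2 * ‖P.A (u - z)‖ ^ 2 := by positivity
  linarith

theorem gradient_g_lipschitz (hP : P.Assumptions) {c : ℝ} (hc : 0 ≤ c) {u z : Vec n}
    (hu : u ∈ effDom P.h)
    (hz : z ∈ effDom P.h) :
    ‖gradient (P.g c) u - gradient (P.g c) z‖ ≤ (P.Lf + c * ‖P.A‖ ^ 2) * ‖u - z‖ := by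
  rw [(P.hasGradientAt_g (hP.f_diff u hu) c).gradient,
    (P.hasGradientAt_g (hP.f_diff z hz) c).gradient, add_sub_add_comm, ← map_sub, ← smul_sub,
    sub_sub_sub_cancel_right, ← map_sub, map_smul]
  refine (norm_add_le _ _).trans ?_
  rw [norm_smul, Real.norm_eq_abs, abs_of_nonneg hc, add_mul]
  refine add_le_add (hP.f_lip z hz u hu) ?_
  rw [mul_assoc]
  refine mul_le_mul_of_nonneg_left ?_ hc
  have h1 := (ContinuousLinearMap.adjoint P.A).le_opNorm (P.A (u - z))
  rw [LinearIsometryEquiv.norm_map] at h1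
  have h2 := mul_le_mul_of_nonneg_left (P.A.le_opNorm (u - z)) (norm_nonneg P.A)
  linarith

theorem aipp_regular (hP : P.Assumptions) {σ ρ c : ℝ} (hσ0 : 0 < σ) (hσ1 : σ < 1)
    (hρ : 0 < ρ) (hc : 0 ≤ c) :
    (P.aipp σ ρ c).Regular where
  conv := hP.h_conv
  lam_pos := hP.lam_pos
  diff := fun z hz => (P.hasGradientAt_g (hP.f_diff z hz) c).differentiableAt
  lower := fun u hu z hz => by
    have h := mul_le_mul_of_nonneg_left (hP.g_lower hc hu hz) hP.lam_pos.le
    have e : P.lam * (P.mf / 2 * ‖u - z‖ ^ 2) = 1 / 4 * ‖u - z‖ ^ 2 := by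
      have := hP.mf_pos
      unfold Problem.lam
      field_simp; ring
    change P.lam * affApprox (P.g c) u z - 1 / 4 * ‖u - z‖ ^ 2 ≤ P.lam * P.g c u
    linarith
  upper := fun u hu z hz => hP.g_upper hc hu hz
  half_le := by
    change 1 / 2 ≤ 1 / (2 * P.mf) * (P.Lf + c * ‖P.A‖ ^ 2)
    have h1 := hP.mf_pos
    have h2 := hP.mf_le_Lf
    have h3 : 0 ≤ c * ‖P.A‖ ^ 2 := by positivity
    rw [div_mul_eq_mul_div, one_mul, div_le_div_iff₀ (by norm_num) (by positivity)]
    linarith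
  σ_pos := hσ0
  σ_lt_one := hσ1
  ρ_pos := by change 0 < ρ / 4; positivity
  tol := by
    change 9 * (1 / (2 * P.mf)) * (ρ / 4) ^ 2
      ≤ 50 * (1 / (2 * P.mf) * (P.Lf + c * ‖P.A‖ ^ 2) + 1 / 2)
        * (ρ ^ 2 / (32 * (P.Lf + c * ‖P.A‖ ^ 2 + 2 * P.mf)))
    have h1 := hP.mf_pos
    have h2 := hP.mf_le_Lf
    have h3 : 0 ≤ c * ‖P.A‖ ^ 2 := by positivity
    set M := P.Lf + c * ‖P.A‖ ^ 2
    have hM : P.mf ≤ M := by simp only [M]; linarith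
    have hM0 : 0 < M := h1.trans_le hM
    have e1 : 9 * (1 / (2 * P.mf)) * (ρ / 4) ^ 2 = 9 / (32 * P.mf) * ρ ^ 2 := by
      field_simp; norm_num
    have e2 : 50 * (1 / (2 * P.mf) * M + 1 / 2) * (ρ ^ 2 / (32 * (M + 2 * P.mf)))
        = 25 * (M + P.mf) / (32 * P.mf * (M + 2 * P.mf)) * ρ ^ 2 := by
      field_simp; ring
    rw [e1, e2]
    -- What remains is equivalent to `9 (M + 2 m_f) ≤ 25 (M + m_f)`.
    gcongr ?_ * ρ ^ 2
    rw [div_le_div_iff₀ (by positivity) (by positivity)]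
    nlinarith [mul_pos h1 h1, mul_pos h1 hM0]

end Assumptions

/-- The penalized objective on the effective domain of `h`. -/
noncomputable def val (P : Problem n l) (c : ℝ) (w : Vec n) : ℝ := P.g c w + (P.h w).toReal

theorem val_eq_add (P : Problem n l) (c c' : ℝ) (w : Vec n) :
    P.val c w = P.val c' w + (c - c') / 2 * ‖P.A w - P.b‖ ^ 2 := by
  unfold val Problem.g; ring

theorem val_eq_of_feasible (P : Problem n l) (c c' : ℝ) {w : Vec n} (hw : w ∈ P.feasible) :
    P.val c w = P.val c' w := by
  rw [P.val_eq_add c c', hw.2]; simp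

namespace Assumptions

theorem φ_eq (hP : P.Assumptions) (c : ℝ) {w : Vec n} (hw : w ∈ effDom P.h) :
    P.φ c w = ((P.val c w : ℝ) : EReal) := by
  unfold Problem.φ val Problem.g
  rw [← hP.h_conv.coe_toReal hw]
  norm_cast
  rw [EReal.toReal_coe]
  ring

theorem φstar_le (hP : P.Assumptions) {w : Vec n} (hw : w ∈ effDom P.h) :
    (P.φstar P.chat).toReal ≤ P.val P.chat w := by
  have h1 : P.φstar P.chat ≤ ((P.val P.chat w : ℝ) : EReal) := by
    rw [← hP.φ_eq P.chat hw]
    exact iInf_le _ w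
  have h2 := EReal.toReal_le_toReal h1 hP.bdd_below.ne' (EReal.coe_ne_top _)
  rwa [EReal.toReal_coe] at h2

theorem φstar_le_of_le (hP : P.Assumptions) {c : ℝ} (hc : P.chat ≤ c) {w : Vec n}
    (hw : w ∈ effDom P.h) : (P.φstar P.chat).toReal ≤ P.val c w := by
  have h1 := hP.φstar_le hw
  rw [P.val_eq_add c P.chat]
  have : 0 ≤ (c - P.chat) / 2 * ‖P.A w - P.b‖ ^ 2 := by
    have : 0 ≤ c - P.chat := by linarith
    positivity
  linarith

theorem le_R (hP : P.Assumptions) {σ X : ℝ} {z0 : Vec n}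
    (hX : ∀ u ∈ P.feasible, X ≤ 1 / 2 * ‖z0 - u‖ ^ 2
      + (1 - σ) * P.lam * (P.val P.chat u - (P.φstar P.chat).toReal)) :
    X ≤ P.R σ z0 P.chat P.lam := by
  have : Nonempty P.feasible := hP.feasible_nonempty.to_subtype
  refine le_ciInf fun u => ?_
  rw [hP.φ_eq P.chat u.2.1, EReal.toReal_coe]
  exact hX u u.2

theorem R_nonneg (hP : P.Assumptions) {σ : ℝ} (hσ1 : σ < 1) (z0 : Vec n) :
    0 ≤ P.R σ z0 P.chat P.lam := by
  refine hP.le_R fun u hu => ?_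
  have h1 := sub_nonneg.2 (hP.φstar_le hu.1)
  have h2 := hP.lam_pos
  have h3 : 0 < 1 - σ := by linarith
  positivity

/-- The objective gap after one outer iteration of the AIPP method. -/
theorem gap_le (hP : P.Assumptions) {σ ρ c : ℝ} (hσ0 : 0 < σ) (hσ1 : σ < 1) (hρ : 0 < ρ)
    (hc : P.chat ≤ c) {z0 x u : Vec n} {η : ℝ} (h : (P.aipp σ ρ c).IsProxApprox z0 x u η) :
    P.lam * (P.val c x - (P.φstar P.chat).toReal) ≤ P.R σ z0 P.chat P.lam / (1 - σ) := by
  have h1 : 0 < 1 - σ := by linarith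
  rw [le_div_iff₀ h1]
  refine hP.le_R fun w hw => ?_
  have h2 := (hP.aipp_regular hσ0 hσ1 hρ (hP.chat_nonneg.trans hc)).val_gap_le
    (w := w) hw.1 h
  change (1 - σ) * (P.lam * P.val c x) ≤ (1 - σ) * (P.lam * P.val c w) + _ at h2
  rw [P.val_eq_of_feasible c P.chat hw] at h2
  linarith

end Assumptions

end Problem

theorem one_le_logOnePlus (t : ℝ) : 1 ≤ logOnePlus t := le_max_right _ _

namespace Problem

variable {P : Problem n l}

/-- The constant of the complexity bound of a single AIPP call. -/
noncomputable def callConst (σ : ℝ) : ℝ := 32000 * √(3 / 2 / σ) / (1 - σ) ^ 2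

theorem callConst_pos {σ : ℝ} (hσ0 : 0 < σ) (hσ1 : σ < 1) : 0 < callConst σ := by
  have : 0 < 1 - σ := by linarith
  unfold callConst
  positivity

/-- The bracket `m_f² R / ρ² + log₁⁺ Θ` of the complexity bound. -/
noncomputable def bracket (P : Problem n l) (σ ρ η : ℝ) (z0 : Vec n) : ℝ :=
  P.mf ^ 2 * P.R σ z0 P.chat P.lam / ρ ^ 2 + logOnePlus (P.Θ σ z0 η)

namespace Assumptions

/-! ### A single AIPP call -/

theorem mul_Θ (hP : P.Assumptions) (σ : ℝ) (z0 : Vec n) (η : ℝ) :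
    P.mf * P.Θ σ z0 η = P.Lf + P.T σ z0 η * ‖P.A‖ ^ 2 := by
  have := hP.mf_pos
  unfold Problem.Θ
  field_simp

theorem chat_le_T (hP : P.Assumptions) {σ : ℝ} (hσ1 : σ < 1) (z0 : Vec n) (η : ℝ) :
    P.chat ≤ P.T σ z0 η := by
  have h1 := hP.R_nonneg hσ1 z0
  have h2 := hP.lam_pos
  have h3 : 0 < 1 - σ := by linarith
  have : 0 ≤ 2 * P.R σ z0 P.chat P.lam / (η ^ 2 * (1 - σ) * P.lam) := by positivity
  unfold Problem.T
  linarith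

theorem one_le_Θ (hP : P.Assumptions) {σ : ℝ} (hσ1 : σ < 1) (z0 : Vec n) (η : ℝ) :
    1 ≤ P.Θ σ z0 η := by
  have h1 := hP.mul_Θ σ z0 η
  have h2 := hP.chat_nonneg.trans (hP.chat_le_T hσ1 z0 η)
  have h3 : 0 ≤ P.T σ z0 η * ‖P.A‖ ^ 2 := by positivity
  have h4 := hP.mf_le_Lf
  refine le_of_mul_le_mul_left ?_ hP.mf_pos
  linarith

theorem one_le_bracket (hP : P.Assumptions) {σ : ℝ} (hσ1 : σ < 1) (ρ η : ℝ) (z0 : Vec n) :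
    1 ≤ P.bracket σ ρ η z0 := by
  have h1 := hP.R_nonneg hσ1 z0
  have h2 : 0 ≤ P.mf ^ 2 * P.R σ z0 P.chat P.lam / ρ ^ 2 := by positivity
  have := one_le_logOnePlus (P.Θ σ z0 η)
  unfold bracket
  linarith

/-- The condition `Lf ≤ c ‖A‖²` makes the subproblem curvature comparable to `c ‖A‖² / m_f`, and the
upper bound on `c` by `Θ` turns its logarithm into `log₁⁺ Θ`. The gap bound, divided by the
guaranteed decrease, produces the term `m_f² R / ρ²`. -/
theorem aipp_run_le (hP : P.Assumptions) {σ ρ η c : ℝ} (hσ0 : 0 < σ) (hσ1 : σ < 1)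
    (hρ : 0 < ρ) (hc : P.chat ≤ c) (hcL : P.Lf ≤ c * ‖P.A‖ ^ 2) {z0 : Vec n}
    (hcΘ : c * ‖P.A‖ ^ 2 ≤ 2 * (P.mf * P.Θ σ z0 η))
    (hz0 : z0 ∈ effDom P.h) {o : AIPPOutput n} {N : ℕ} (h : (P.aipp σ ρ c).Run z0 o N) :
    (N : ℝ) ≤ callConst σ * P.bracket σ ρ η z0 * √(c * ‖P.A‖ ^ 2 / P.mf) := by
  have hc0 := hP.chat_nonneg.trans hc
  have hreg := hP.aipp_regular hσ0 hσ1 hρ hc0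
  have h1 := (hreg.run_le_of_gap (fun w hw => hP.φstar_le_of_le hc hw) hz0
    (fun x u η hx => hP.gap_le hσ0 hσ1 hρ hc hx) h).2
  have hm := hP.mf_pos
  have hmL := hP.mf_le_Lf
  have hR := hP.R_nonneg hσ1 z0
  have hΘ := hP.one_le_Θ hσ1 z0 η
  have hδ := hreg.decrease_pos
  have hδe : (P.aipp σ ρ c).decrease = (1 - σ) * ρ ^ 2 / (3200 * P.mf ^ 2) := by
    change (1 - σ) / 2 * (1 / (2 * P.mf) * (ρ / 4) / 5) ^ 2 = _
    field_simp; ring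
  have hK1 := hreg.approxIters_le
  have hK3 := hreg.accurateIters_le
  have hcurv : (P.aipp σ ρ c).curv ≤ 3 / 2 * (c * ‖P.A‖ ^ 2 / P.mf) := by
    change 1 / (2 * P.mf) * (P.Lf + c * ‖P.A‖ ^ 2) + 1 / 2 ≤ _
    have e : 1 / (2 * P.mf) * (P.Lf + c * ‖P.A‖ ^ 2) + 1 / 2
        = (P.Lf + c * ‖P.A‖ ^ 2 + P.mf) / (2 * P.mf) := by field_simp
    rw [e, mul_div_assoc', div_le_div_iff₀ (by positivity) hm]
    nlinarith
  have hc1 := hreg.one_le_curv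
  have hcurvΘ : (P.aipp σ ρ c).curv ≤ 3 * P.Θ σ z0 η := by
    have : c * ‖P.A‖ ^ 2 / P.mf ≤ 2 * P.Θ σ z0 η := by
      rw [div_le_iff₀ hm]; linarith
    linarith
  have hlog : Real.log (2 * (P.aipp σ ρ c).curv) ≤ 4 * logOnePlus (P.Θ σ z0 η) := by
    -- The factor `6` is rounded up to `8 = 2³`, and `3 log 2 < 3` gives the total factor `1 + 3`.
    have g1 : Real.log (2 * (P.aipp σ ρ c).curv) ≤ Real.log (8 * P.Θ σ z0 η) :=
      Real.log_le_log (by linarith) (by linarith)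
    have g0 : Real.log 8 = 3 * Real.log 2 := by
      rw [show (8 : ℝ) = 2 ^ 3 by norm_num, Real.log_pow]
      norm_num
    rw [Real.log_mul (x := 8) (by norm_num) (by linarith), g0] at g1
    have g2 : Real.log (P.Θ σ z0 η) ≤ logOnePlus (P.Θ σ z0 η) := le_max_left _ _
    have g3 : 1 ≤ logOnePlus (P.Θ σ z0 η) := le_max_right _ _
    have g4 := Real.log_two_lt_d9
    linarith
  have hq : √((P.aipp σ ρ c).curv / σ) ≤ √(3 / 2 / σ) * √(c * ‖P.A‖ ^ 2 / P.mf) := by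
    rw [← Real.sqrt_mul (by positivity)]
    apply Real.sqrt_le_sqrt
    rw [div_mul_eq_mul_div]
    gcongr
  change _ ≤ 10 * √((P.aipp σ ρ c).curv / σ) at hK1
  change _ ≤ √((P.aipp σ ρ c).curv / σ) * _ at hK3
  set q := √((P.aipp σ ρ c).curv / σ)
  have hq0 : 0 ≤ q := Real.sqrt_nonneg _
  have h1σ : 0 < 1 - σ := by linarith
  set X := P.mf ^ 2 * P.R σ z0 P.chat P.lam / ρ ^ 2 with hX
  have hX0 : 0 ≤ X := by positivity
  set Λ := logOnePlus (P.Θ σ z0 η)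
  have hΛ : 1 ≤ Λ := one_le_logOnePlus _
  have hB : P.R σ z0 P.chat P.lam / (1 - σ)
      = 3200 * X / (1 - σ) ^ 2 * (P.aipp σ ρ c).decrease := by
    rw [hδe, hX]; field_simp
  rw [hB] at h1
  have h2 : (N : ℝ) ≤ (P.aipp σ ρ c).approxIters * (3200 * X / (1 - σ) ^ 2)
      + ((P.aipp σ ρ c).approxIters + (P.aipp σ ρ c).accurateIters) := by
    refine le_of_mul_le_mul_right ?_ hδ
    linarith
  have hs1 : 1 ≤ 1 / (1 - σ) ^ 2 := by
    rw [one_le_div (by positivity)]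
    nlinarith
  have h3 : (P.aipp σ ρ c).approxIters * (3200 * X / (1 - σ) ^ 2)
      ≤ 10 * q * (3200 * X / (1 - σ) ^ 2) := by gcongr
  have h4 : q * (12 + 4 * Real.log (2 * (P.aipp σ ρ c).curv)) ≤ q * (12 + 4 * (4 * Λ)) := by
    gcongr
  have h5 : (N : ℝ) ≤ q * (32000 / (1 - σ) ^ 2 * (X + Λ)) := by
    have e1 : 10 * q * (3200 * X / (1 - σ) ^ 2) = q * (32000 / (1 - σ) ^ 2 * X) := by ring
    have e2 : q * (38 * Λ) ≤ q * (32000 / (1 - σ) ^ 2 * Λ) := by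
      gcongr
      have : 32000 / (1 - σ) ^ 2 = 32000 * (1 / (1 - σ) ^ 2) := by ring
      linarith
    have e3 : q * 1 ≤ q * Λ := by gcongr
    rw [mul_add, mul_add]
    linarith
  refine h5.trans ?_
  have h6 : q * (32000 / (1 - σ) ^ 2 * (X + Λ))
      ≤ √(3 / 2 / σ) * √(c * ‖P.A‖ ^ 2 / P.mf) * (32000 / (1 - σ) ^ 2 * (X + Λ)) := by
    gcongr
  refine h6.trans (le_of_eq ?_)
  unfold callConst bracket
  ring

theorem aipp_run_val_le (hP : P.Assumptions) {σ ρ c : ℝ} (hσ0 : 0 < σ) (hσ1 : σ < 1)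
    (hρ : 0 < ρ) (hc : P.chat ≤ c) {z0 : Vec n} (hz0 : z0 ∈ effDom P.h) {o : AIPPOutput n}
    {N : ℕ} (h : (P.aipp σ ρ c).Run z0 o N) :
    P.lam * (P.val c o.z - (P.φstar P.chat).toReal) ≤ P.R σ z0 P.chat P.lam / (1 - σ) :=
  ((hP.aipp_regular hσ0 hσ1 hρ (hP.chat_nonneg.trans hc)).run_le_of_gap
    (fun _ hw => hP.φstar_le_of_le hc hw) hz0
    (fun _ _ _ hx => hP.gap_le hσ0 hσ1 hρ hc hx) h).1

theorem aipp_run_mem (hP : P.Assumptions) {σ ρ c : ℝ} (hσ0 : 0 < σ) (hσ1 : σ < 1)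
    (hρ : 0 < ρ) (hc : 0 ≤ c) {z0 : Vec n} (hz0 : z0 ∈ effDom P.h) {o : AIPPOutput n}
    {N : ℕ} (h : (P.aipp σ ρ c).Run z0 o N) : o.z ∈ effDom P.h := by
  have hreg := hP.aipp_regular hσ0 hσ1 hρ hc
  obtain ⟨_, zp, u, e, hp, -⟩ := hreg.run_output h hz0
  exact (hreg.isProxApprox_iff.1 hp).2.1

/-- An AIPP call whose refined output is not nearly feasible has a small penalty parameter. -/
theorem le_T_of_infeasible (hP : P.Assumptions) {σ ρ η c : ℝ} (hσ0 : 0 < σ) (hσ1 : σ < 1)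
    (hρ : 0 < ρ) (hη : 0 < η) (hc : P.chat ≤ c) {z0 : Vec n} (hz0 : z0 ∈ effDom P.h)
    {o : AIPPOutput n} {N : ℕ} (h : (P.aipp σ ρ c).Run z0 o N)
    (hfail : η < ‖P.A ((P.aipp σ ρ c).zg o.z) - P.b‖) : c ≤ P.T σ z0 η := by
  have hreg := hP.aipp_regular hσ0 hσ1 hρ (hP.chat_nonneg.trans hc)
  have h1 := hP.aipp_run_val_le hσ0 hσ1 hρ hc hz0 h
  have hoz := hP.aipp_run_mem hσ0 hσ1 hρ (hP.chat_nonneg.trans hc) hz0 h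
  have hl := hP.lam_pos
  have h1σ : 0 < 1 - σ := by linarith
  set zg := (P.aipp σ ρ c).zg o.z
  have h2 : P.val c zg + ((P.aipp σ ρ c).M / 2 + (P.aipp σ ρ c).lam⁻¹) * ‖zg - o.z‖ ^ 2
    ≤ P.val c o.z := hreg.val_zg_le hoz
  have h3 : 0 ≤ ((P.aipp σ ρ c).M / 2 + (P.aipp σ ρ c).lam⁻¹) * ‖zg - o.z‖ ^ 2 := by
    have h4 : 0 ≤ (P.aipp σ ρ c).M := by
      by_contra! hneg
      nlinarith [hreg.half_le, hreg.lam_pos]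
    have h5 := hreg.lam_pos
    positivity
  have h4 := hP.φstar_le (hreg.zg_spec o.z).1
  change _ ≤ P.val P.chat zg at h4
  have h5 := P.val_eq_add c P.chat zg
  have h6 : η ^ 2 ≤ ‖P.A zg - P.b‖ ^ 2 := pow_le_pow_left₀ hη.le hfail.le 2
  have h7 : (c - P.chat) / 2 * η ^ 2 ≤ (c - P.chat) / 2 * ‖P.A zg - P.b‖ ^ 2 := by
    have : 0 ≤ (c - P.chat) / 2 := by linarith
    gcongr
  -- The excess penalty at the refined point is part of its gap above `inf φ_chat`, which is no
  -- larger than the gap at the AIPP output; solving for `c` gives the threshold `T`.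
  have h8 : P.lam * ((c - P.chat) / 2 * η ^ 2) ≤ P.R σ z0 P.chat P.lam / (1 - σ) := by
    refine le_trans ?_ h1
    gcongr
    linarith
  rw [le_div_iff₀ h1σ] at h8
  unfold Problem.T
  rw [← sub_le_iff_le_add, le_div_iff₀ (by positivity)]
  linarith

/-- The penalty part of the gradient of `g_c` at the refined point is `A* p`. The Lipschitz constant
of that gradient is `M ≤ M + λ⁻¹`, so `‖v‖` is at most twice the bound `2 (ρ / 4)` of `zg_dist_le`;
hence the factor `4` in the AIPP tolerance. -/
theorem isApproxSolution (hP : P.Assumptions) {σ ρ η c : ℝ} (hσ0 : 0 < σ) (hσ1 : σ < 1)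
    (hρ : 0 < ρ) (hc : 0 ≤ c) {z0 : Vec n} (hz0 : z0 ∈ effDom P.h)
    {o : AIPPOutput n} {N : ℕ} (h : (P.aipp σ ρ c).Run z0 o N)
    (hfeas : ‖P.A ((P.aipp σ ρ c).zg o.z) - P.b‖ ≤ η) :
    P.IsApproxSolution ρ η
      { z := (P.aipp σ ρ c).zg o.z
        v := (P.aipp σ ρ c).vg o.z
        p := c • (P.A ((P.aipp σ ρ c).zg o.z) - P.b) } := by
  have hreg := hP.aipp_regular hσ0 hσ1 hρ hc
  obtain ⟨_, zp, u, e, hp, hr, he⟩ := hreg.run_output h hz0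
  have hoz := (hreg.isProxApprox_iff.1 hp).2.1
  have hzg := (hreg.zg_spec o.z).1
  refine ⟨⟨_, hreg.subdiff_zg o.z, ?_⟩, ?_, hfeas⟩
  · have hg := (P.hasGradientAt_g (hP.f_diff _ hzg) c).gradient
    change gradient (P.aipp σ ρ c).g _ = _ at hg
    dsimp only
    unfold AIPPInput.vg
    rw [hg]
    abel
  · have hK := hreg.grad_const_pos
    have hm := hP.mf_pos
    have hle : (P.aipp σ ρ c).M + (P.aipp σ ρ c).lam⁻¹
        = P.Lf + c * ‖P.A‖ ^ 2 + 2 * P.mf := by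
      change P.Lf + c * ‖P.A‖ ^ 2 + (1 / (2 * P.mf))⁻¹ = _
      rw [one_div, inv_inv]
    have h1 := hreg.zg_dist_le hp hr he (by
      have h0 : 0 < P.Lf + c * ‖P.A‖ ^ 2 + 2 * P.mf := by rw [← hle]; exact hK
      rw [hle]
      change 2 * (P.Lf + c * ‖P.A‖ ^ 2 + 2 * P.mf)
        * (ρ ^ 2 / (32 * (P.Lf + c * ‖P.A‖ ^ 2 + 2 * P.mf))) ≤ (ρ / 4) ^ 2
      refine le_of_eq ?_
      field_simp; norm_num)
    have h2 := (P.aipp σ ρ c).vg_norm_le (hP.gradient_g_lipschitz hc hzg hoz) hK.le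
    change _ ≤ 2 * (ρ / 4) at h1
    dsimp only
    rw [hle] at h1 h2
    have h3 : 0 ≤ P.mf * ‖(P.aipp σ ρ c).zg o.z - o.z‖ := by positivity
    nlinarith

/-! ### Runs of the QP-AIPP method -/

theorem exists_runFrom (hP : P.Assumptions) {σ ρ η c : ℝ} (hσ0 : 0 < σ) (hσ1 : σ < 1)
    (hρ : 0 < ρ) (hη : 0 < η) (hc : P.chat ≤ c) (hc0 : 0 < c) {z0 : Vec n}
    (hz0 : z0 ∈ effDom P.h) : ∃ out N, P.RunFrom σ ρ η z0 c out N := by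
  obtain ⟨k, hk⟩ := pow_unbounded_of_one_lt (P.T σ z0 η / c) one_lt_two
  rw [div_lt_iff₀ hc0] at hk
  induction k generalizing c with
  | zero =>
    obtain ⟨o, N, h⟩ := (hP.aipp_regular hσ0 hσ1 hρ hc0.le).exists_run
      (fun w hw => hP.φstar_le_of_le hc hw) hz0
    rcases le_or_gt ‖P.A ((P.aipp σ ρ c).zg o.z) - P.b‖ η with hf | hf
    · exact ⟨_, _, RunFrom.last c o N h hf⟩
    · have := hP.le_T_of_infeasible hσ0 hσ1 hρ hη hc hz0 h hf
      linarith
  | succ k ih =>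
    obtain ⟨o, N, h⟩ := (hP.aipp_regular hσ0 hσ1 hρ hc0.le).exists_run
      (fun w hw => hP.φstar_le_of_le hc hw) hz0
    rcases le_or_gt ‖P.A ((P.aipp σ ρ c).zg o.z) - P.b‖ η with hf | hf
    · exact ⟨_, _, RunFrom.last c o N h hf⟩
    · obtain ⟨out, N', h'⟩ := ih (c := 2 * c) (by linarith) (by linarith)
        (by rw [pow_succ] at hk; linarith)
      exact ⟨out, N + N', RunFrom.next c o N out N' h hf h'⟩

/-- The negative term makes the bound inductive: it is a potential that absorbs the cost of a call
each time `c` doubles. The invariant on `c` and `Θ` survives doubling because a failed test implies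
`c ≤ T`. -/
theorem runFrom_spec (hP : P.Assumptions) {σ ρ η c : ℝ} (hσ0 : 0 < σ) (hσ1 : σ < 1)
    (hρ : 0 < ρ) (hη : 0 < η) {z0 : Vec n} (hz0 : z0 ∈ effDom P.h) {out : Output n l} {N : ℕ}
    (h : P.RunFrom σ ρ η z0 c out N) (hc : P.chat ≤ c) (hcL : P.Lf ≤ c * ‖P.A‖ ^ 2)
    (hcΘ : c * ‖P.A‖ ^ 2 ≤ 2 * (P.mf * P.Θ σ z0 η)) :
    P.IsApproxSolution ρ η out ∧
      (N : ℝ) ≤ callConst σ * P.bracket σ ρ η z0 *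
        (4 * √(2 * P.Θ σ z0 η) - 3 * √(c * ‖P.A‖ ^ 2 / P.mf)) := by
  have hm := hP.mf_pos
  have hG : 0 ≤ callConst σ * P.bracket σ ρ η z0 :=
    mul_nonneg (callConst_pos hσ0 hσ1).le (by linarith [hP.one_le_bracket hσ1 ρ η z0])
  induction h with
  | last c o N h hf =>
    refine ⟨hP.isApproxSolution hσ0 hσ1 hρ (hP.chat_nonneg.trans hc) hz0 h hf, ?_⟩
    refine (hP.aipp_run_le hσ0 hσ1 hρ hc hcL hcΘ hz0 h).trans ?_
    refine mul_le_mul_of_nonneg_left ?_ hG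
    have : √(c * ‖P.A‖ ^ 2 / P.mf) ≤ √(2 * P.Θ σ z0 η) := by
      apply Real.sqrt_le_sqrt
      rw [div_le_iff₀ hm]
      linarith
    linarith
  | next c o N out N' h hf h' ih =>
    have hcT := hP.le_T_of_infeasible hσ0 hσ1 hρ hη hc hz0 h hf
    have hc0 := hP.chat_nonneg
    have hA : 0 ≤ ‖P.A‖ ^ 2 := by positivity
    have hcA : c * ‖P.A‖ ^ 2 ≤ P.T σ z0 η * ‖P.A‖ ^ 2 := by gcongr
    have hLf := hP.Lf_pos
    obtain ⟨i1, i2⟩ := ih (by linarith) (by linarith) (by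
      rw [hP.mul_Θ]; linarith)
    refine ⟨i1, ?_⟩
    have h1 := hP.aipp_run_le hσ0 hσ1 hρ hc hcL hcΘ hz0 h
    have e : √(2 * c * ‖P.A‖ ^ 2 / P.mf) = √2 * √(c * ‖P.A‖ ^ 2 / P.mf) := by
      rw [← Real.sqrt_mul (by norm_num)]
      congr 1; ring
    rw [e] at i2
    -- With `s = √(c ‖A‖² / m_f)`, the induction needs `s - 3 √2 s ≤ -3 s`.
    have h2 : (4 : ℝ) / 3 ≤ √2 := Real.le_sqrt_of_sq_le (by norm_num)
    have h3 := Real.sqrt_nonneg (c * ‖P.A‖ ^ 2 / P.mf)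
    set s := √(c * ‖P.A‖ ^ 2 / P.mf)
    set G := callConst σ * P.bracket σ ρ η z0
    have h4 : G * (4 / 3 * s) ≤ G * (√2 * s) := by gcongr
    push_cast
    linarith

theorem run_spec (hP : P.Assumptions) {σ ρ η : ℝ} (hσ0 : 0 < σ) (hσ1 : σ < 1)
    (hρ : 0 < ρ) (hη : 0 < η) {z0 : Vec n} (hz0 : z0 ∈ effDom P.h) {out : Output n l} {N : ℕ}
    (h : P.Run σ ρ η z0 out N) :
    P.IsApproxSolution ρ η out ∧
      (N : ℝ) ≤ 4 * √2 * callConst σ * (√(P.Θ σ z0 η) * P.bracket σ ρ η z0) := by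
  have hA := hP.normA_pos
  have hLf := hP.Lf_pos
  have hc0 := hP.chat_nonneg
  have e : (P.chat + P.Lf / ‖P.A‖ ^ 2) * ‖P.A‖ ^ 2 = P.chat * ‖P.A‖ ^ 2 + P.Lf := by
    field_simp
  have h1 : 0 ≤ P.Lf / ‖P.A‖ ^ 2 := by positivity
  have h2 : 0 ≤ P.chat * ‖P.A‖ ^ 2 := by positivity
  have h3 : P.chat * ‖P.A‖ ^ 2 ≤ P.T σ z0 η * ‖P.A‖ ^ 2 := by
    have := hP.chat_le_T hσ1 z0 η
    gcongr
  obtain ⟨g1, g2⟩ := hP.runFrom_spec hσ0 hσ1 hρ hη hz0 h (by linarith) (by linarith)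
    (by rw [hP.mul_Θ]; linarith)
  refine ⟨g1, g2.trans ?_⟩
  have hG : 0 ≤ callConst σ * P.bracket σ ρ η z0 :=
    mul_nonneg (callConst_pos hσ0 hσ1).le (by linarith [hP.one_le_bracket hσ1 ρ η z0])
  have h4 := mul_nonneg hG (Real.sqrt_nonneg ((P.chat + P.Lf / ‖P.A‖ ^ 2) * ‖P.A‖ ^ 2 / P.mf))
  rw [Real.sqrt_mul (by norm_num) (P.Θ σ z0 η)]
  linarith

theorem exists_run (hP : P.Assumptions) {σ ρ η : ℝ} (hσ0 : 0 < σ) (hσ1 : σ < 1)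
    (hρ : 0 < ρ) (hη : 0 < η) {z0 : Vec n} (hz0 : z0 ∈ effDom P.h) :
    ∃ out N, P.Run σ ρ η z0 out N := by
  have hA := hP.normA_pos
  have hLf := hP.Lf_pos
  have hc0 := hP.chat_nonneg
  have h1 : 0 < P.Lf / ‖P.A‖ ^ 2 := by positivity
  exact hP.exists_runFrom hσ0 hσ1 hρ hη (by linarith) (by linarith) hz0

/-! ### The bound in terms of the tolerances -/

/-- Only one summand of `Θ` depends on `η`, and it scales exactly like `1 / η²`; the others only
shrink when multiplied by `η² ≤ 1`. So `Θ` at `η = 1` is a valid constant. -/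
theorem exists_Θ_le (hP : P.Assumptions) {σ : ℝ} (hσ1 : σ < 1) (z0 : Vec n) :
    ∃ a : ℝ, 1 ≤ a ∧ ∀ η : ℝ, 0 < η → η ≤ 1 → P.Θ σ z0 η ≤ a / η ^ 2 := by
  refine ⟨P.Θ σ z0 1, hP.one_le_Θ hσ1 z0 1, fun η hη hη1 => ?_⟩
  have hm := hP.mf_pos
  have hl := hP.lam_pos
  have h1σ : 0 < 1 - σ := by linarith
  have hLf := hP.Lf_pos
  have hc := hP.chat_nonneg
  have hη2 : η ^ 2 ≤ 1 := pow_le_one₀ hη.le hη1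
  rw [le_div_iff₀ (by positivity)]
  refine le_of_mul_le_mul_left ?_ hm
  rw [← mul_assoc, hP.mul_Θ, hP.mul_Θ]
  unfold Problem.T
  have e : 2 * P.R σ z0 P.chat P.lam / (η ^ 2 * (1 - σ) * P.lam) * η ^ 2
      = 2 * P.R σ z0 P.chat P.lam / (1 ^ 2 * (1 - σ) * P.lam) := by
    field_simp
  have h1 : (P.Lf + P.chat * ‖P.A‖ ^ 2) * η ^ 2 ≤ (P.Lf + P.chat * ‖P.A‖ ^ 2) * 1 := by
    gcongr
  linear_combination h1 + ‖P.A‖ ^ 2 * e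

theorem exists_bound (hP : P.Assumptions) {σ : ℝ} (hσ0 : 0 < σ) (hσ1 : σ < 1) {z0 : Vec n}
    (hz0 : z0 ∈ effDom P.h) :
    ∃ C : ℝ, 0 < C ∧ ∀ ρ η : ℝ, 0 < ρ → ρ ≤ 1 → 0 < η → η ≤ 1 →
      ∀ (out : Output n l) (N : ℕ), P.Run σ ρ η z0 out N →
        (N : ℝ) ≤ C * ((1 / ρ ^ 2 + logOnePlus (1 / η)) / η) := by
  obtain ⟨a, ha, hΘ⟩ := hP.exists_Θ_le hσ1 z0
  have hR := hP.R_nonneg hσ1 z0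
  set R := P.R σ z0 P.chat P.lam with hRdef
  have hlog := Real.log_nonneg ha
  set B := P.mf ^ 2 * R + Real.log a + 3 with hB
  have hB0 : 0 < B := by positivity
  have hE := callConst_pos hσ0 hσ1
  refine ⟨4 * √2 * callConst σ * (√a * B), by positivity, fun ρ η hρ hρ1 hη hη1 out N h => ?_⟩
  refine (hP.run_spec hσ0 hσ1 hρ hη hz0 h).2.trans ?_
  have hΘη := hΘ η hη hη1
  have hΘ1 := hP.one_le_Θ hσ1 z0 η
  have h1 : √(P.Θ σ z0 η) ≤ √a / η := by
    rw [← Real.sqrt_sq hη.le, ← Real.sqrt_div (by linarith)]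
    exact Real.sqrt_le_sqrt (by rwa [Real.sqrt_sq hη.le])
  have hΛ := one_le_logOnePlus (1 / η)
  -- `log Θ ≤ log a + 2 log (1 / η)`, and `log₁⁺ (1 / η) ≥ 1` absorbs the constant `log a`.
  have h2 : logOnePlus (P.Θ σ z0 η) ≤ (Real.log a + 3) * logOnePlus (1 / η) := by
    refine max_le ?_ (by nlinarith)
    have g1 := Real.log_le_log (by linarith) hΘη
    rw [Real.log_div (by linarith) (by positivity), Real.log_pow] at g1
    have g2 : Real.log (1 / η) ≤ logOnePlus (1 / η) := le_max_left _ _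
    rw [Real.log_div one_ne_zero hη.ne', Real.log_one] at g2
    push_cast at g1
    nlinarith
  have h3 : P.bracket σ ρ η z0 ≤ B * (1 / ρ ^ 2 + logOnePlus (1 / η)) := by
    unfold bracket
    have g1 : 0 ≤ 1 / ρ ^ 2 := by positivity
    have g2 : P.mf ^ 2 * R / ρ ^ 2 = P.mf ^ 2 * R * (1 / ρ ^ 2) := by ring
    have g3 : 0 ≤ P.mf ^ 2 * R := by positivity
    rw [← hRdef, g2, hB]
    nlinarith [mul_nonneg hlog g1, mul_nonneg g3 (zero_le_one.trans hΛ)]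
  have h4 : 0 ≤ P.bracket σ ρ η z0 := by linarith [hP.one_le_bracket hσ1 ρ η z0]
  calc 4 * √2 * callConst σ * (√(P.Θ σ z0 η) * P.bracket σ ρ η z0)
      ≤ 4 * √2 * callConst σ * (√a / η * (B * (1 / ρ ^ 2 + logOnePlus (1 / η)))) := by gcongr
    _ = 4 * √2 * callConst σ * (√a * B) * ((1 / ρ ^ 2 + logOnePlus (1 / η)) / η) := by ring

end Assumptions

end Problem

/-! ### Absorbing the logarithm, and the main theorem -/

theorem inv_sq_add_logOnePlus_le {K ρ η : ℝ} (hρ : 0 < ρ) (hρ1 : ρ ≤ 1)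
    (hK : Real.log (1 / η) ≤ K / ρ ^ 2) :
    1 / ρ ^ 2 + logOnePlus (1 / η) ≤ (1 + max K 1) / ρ ^ 2 := by
  have h1 : logOnePlus (1 / η) ≤ max K 1 / ρ ^ 2 := by
    refine max_le (hK.trans ?_) ?_
    · gcongr; exact le_max_left _ _
    · rw [le_div_iff₀ (by positivity), one_mul]
      exact (pow_le_one₀ hρ.le hρ1).trans (le_max_right _ _)
  rw [add_div]
  linarith

end QPAIPP

theorem mainTheorem1 (σ : ℝ) (hσ0 : 0 < σ) (hσ1 : σ < 1) :
    (∃ C : ℝ, 0 < C ∧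
      ∀ (n l : ℕ) (P : QPAIPP.Problem n l), P.Assumptions →
      ∀ z0 ∈ QPAIPP.effDom P.h, ∀ ρ η : ℝ, 0 < ρ → 0 < η →
        (∃ (out : QPAIPP.Output n l) (N : ℕ), P.Run σ ρ η z0 out N) ∧
        ∀ (out : QPAIPP.Output n l) (N : ℕ), P.Run σ ρ η z0 out N →
          P.IsApproxSolution ρ η out ∧
          (N : ℝ) ≤ C * (Real.sqrt (P.Θ σ z0 η) *
            (P.mf ^ 2 * P.R σ z0 P.chat P.lam / ρ ^ 2 + QPAIPP.logOnePlus (P.Θ σ z0 η)))) ∧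
    (∀ (n l : ℕ) (P : QPAIPP.Problem n l), P.Assumptions →
      ∀ z0 ∈ QPAIPP.effDom P.h,
        (∃ C : ℝ, 0 < C ∧ ∀ ρ η : ℝ, 0 < ρ → ρ ≤ 1 → 0 < η → η ≤ 1 →
          ∀ (out : QPAIPP.Output n l) (N : ℕ), P.Run σ ρ η z0 out N →
            (N : ℝ) ≤ C * ((1 / ρ ^ 2 + QPAIPP.logOnePlus (1 / η)) / η)) ∧
        (∀ K : ℝ, ∃ C : ℝ, 0 < C ∧ ∀ ρ η : ℝ, 0 < ρ → ρ ≤ 1 → 0 < η → η ≤ 1 →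
          Real.log (1 / η) ≤ K / ρ ^ 2 →
          ∀ (out : QPAIPP.Output n l) (N : ℕ), P.Run σ ρ η z0 out N →
            (N : ℝ) ≤ C * (1 / (ρ ^ 2 * η)))) := by
  refine ⟨⟨4 * √2 * QPAIPP.Problem.callConst σ, ?_, fun n l P hP z0 hz0 ρ η hρ hη =>
    ⟨hP.exists_run hσ0 hσ1 hρ hη hz0, fun out N h => hP.run_spec hσ0 hσ1 hρ hη hz0 h⟩⟩,
    fun n l P hP z0 hz0 => ⟨hP.exists_bound hσ0 hσ1 hz0, fun K => ?_⟩⟩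
  · have := QPAIPP.Problem.callConst_pos hσ0 hσ1
    positivity
  · obtain ⟨C, hC, hb⟩ := hP.exists_bound hσ0 hσ1 hz0
    refine ⟨C * (1 + max K 1), by positivity, fun ρ η hρ hρ1 hη hη1 hK out N h => ?_⟩
    refine (hb ρ η hρ hρ1 hη hη1 out N h).trans ?_
    have h1 := QPAIPP.inv_sq_add_logOnePlus_le hρ hρ1 hK
    calc C * ((1 / ρ ^ 2 + QPAIPP.logOnePlus (1 / η)) / η)
        ≤ C * ((1 + max K 1) / ρ ^ 2 / η) := by gcongr
      _ = C * (1 + max K 1) * (1 / (ρ ^ 2 * η)) := by field_simp
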